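/- Agents of two types, $H$ (hard-to-match) and $E$ (easy-to-match), arrive to a market according to independent Poisson processes of rates $\lambda_H,\lambda_E>0$. An agent of type $H$ (resp. $E$) finds the item of any other agent compatible with probability $p_H\in(0,1)$ (resp. $p_E\in(0,1]$), independently over ordered pairs of agents. Under the policy BilateralMatch($H$), if a newly arrived agent forms a 2-cycle of mutual compatibility with at least one waiting agent, she is at once matched with one of these (type $H$ having priority over type $E$, further ties being broken uniformly at random) and both leave; otherwise she joins the market and waits. The numbers of waiting $H$ and $E$ agents form a continuous-time Markov chain on $\mathbb{N}^2$. Let $w_H=w_H(\lambda_H,\lambda_E,p_H,p_E)$ be the average waiting time in steady state of an $H$ agent (the expected difference between her departure and arrival times when the market she arrives to is in its steady-state distribution). Then the equation $(x+1)\ln\bigl(2-\tfrac{2}{x+1}\bigr)=1$ has a unique solution $x^*$, with $x^*\approx 2.18$ (rounded to two decimals), and the following holds for all fixed $\lambda_E>0$ and $p_E\in(0,1]$. For every $\lambda_H>\lambda_E$, the chain has a unique steady-state distribution for every $p_H\in(0,1)$, and the limiting average waiting time $$W(\lambda_H)=\lim_{p_H\to 0^+}p_H^2\,w_H(\lambda_H,\lambda_E,p_H,p_E)$$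 exists and is finite; and $W$ is strictly increasing on the interval $\lambda_E<\lambda_H<x^*\lambda_E$ and strictly decreasing on the interval $\lambda_H>x^*\lambda_E$. -/

import Mathlib

open Set Filter Topology
open scoped ENNReal NNReal Nat

/-- The two types of agents: hard-to-match (`H`) and easy-to-match (`E`). -/
inductive AgentType where
  | H
  | E

/-- Parameters of the market: agents of type `T` arrive according to independent Poisson processes
of rates `lamH`, `lamE`; an agent of type `H` (resp. `E`) finds the item of any other agent
compatible with probability `pH` (resp. `pE`), independently. -/
structure Market where
  lamH : ℝ
  lamE : ℝ
  pH : ℝ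
  pE : ℝ

/-- State of the market: `(h, e)`, the numbers of waiting `H` agents and `E` agents. -/
abbrev MarketState : Type := ℕ × ℕ

/-- The state after a `T` agent has been added. -/
def MarketState.add (s : MarketState) : AgentType → MarketState
  | .H => (s.1 + 1, s.2)
  | .E => (s.1, s.2 + 1)

namespace Market

/-- Arrival rate of `T` agents. -/
def lam (M : Market) : AgentType → ℝ
  | .H => M.lamH
  | .E => M.lamE

/-- Probability that a `T` agent finds a given item compatible. -/
def p (M : Market) : AgentType → ℝ
  | .H => M.pH
  | .E => M.pE

/-- Total arrival rate. -/
def totalRate (M : Market) : ℝ := M.lamH + M.lamE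

/-! Under BilateralMatch(H), a newly arrived agent is matched through a 2-cycle if there is one,
2-cycles with `H` agents having priority over those with `E` agents, and otherwise joins the market.
An arriving `T` agent forms a 2-cycle with each waiting `T'` agent independently with probability
`p T * p T'`. No 2-cycles are present among the agents already waiting. -/

/-- Probability that a `T` agent arriving in state `s` is matched with a waiting `H` agent:
it forms a 2-cycle with at least one of them. -/
noncomputable def matchH (M : Market) (T : AgentType) (s : MarketState) : ℝ :=
  1 - (1 - M.p T * M.pH) ^ s.1

/-- Probability that a `T` agent arriving in state `s` is matched with a waiting `E` agent:
it forms no 2-cycle with an `H` agent, but at least one with an `E` agent. -/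
noncomputable def matchE (M : Market) (T : AgentType) (s : MarketState) : ℝ :=
  (1 - M.p T * M.pH) ^ s.1 * (1 - (1 - M.p T * M.pE) ^ s.2)

/-- Probability that a `T` agent arriving in state `s` forms no 2-cycle, and so joins the market. -/
noncomputable def join (M : Market) (T : AgentType) (s : MarketState) : ℝ :=
  (1 - M.p T * M.pH) ^ s.1 * (1 - M.p T * M.pE) ^ s.2

/-- Rate at which arrivals of `T` agents move the market from `s` to `s'`. -/
noncomputable def arrivalRate (M : Market) (T : AgentType) (s s' : MarketState) : ℝ :=
  M.lam T *
    ((if s' = s.add T then M.join T s else 0) +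
     (if s'.add .H = s then M.matchH T s else 0) +
     (if s'.add .E = s then M.matchE T s else 0))

/-- Transition rates (off the diagonal) of the continuous-time Markov chain of the numbers of
waiting agents under BilateralMatch(H). Every arrival changes the state, so the diagonal is `0`. -/
noncomputable def rate (M : Market) (s s' : MarketState) : ℝ :=
  M.arrivalRate .H s s' + M.arrivalRate .E s s'

/-- `π` is a steady-state (stationary) distribution of the chain: in every state the probability
flow in equals the probability flow out. The rates are bounded, so the chain does not explode. -/
def IsSteadyState (M : Market) (π : PMF MarketState) : Prop :=
  ∀ s, ∑' s', π s' * ENNReal.ofReal (M.rate s' s) = π s * ∑' s', ENNReal.ofReal (M.rate s s')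

/-- Consider a tagged `H` agent who waits in the market, in state `s = (h, e)` (she is counted in
`h`, so `1 ≤ h`). `M.unmatched n s` is the probability that she is still unmatched after the next
`n` arrivals. Each arrival is of type `T` with probability `lam T / totalRate`; if the arriving
agent is matched with one of the `h` waiting `H` agents, ties being broken uniformly at random,
that one is the tagged agent with probability `1 / h`. -/
noncomputable def unmatched (M : Market) : ℕ → MarketState → ℝ
  | 0, _ => 1
  | n + 1, s =>
    let afterArrival (T : AgentType) : ℝ :=
      M.join T s * M.unmatched n (s.add T) +
      M.matchE T s * M.unmatched n (s.1, s.2 - 1) +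
      M.matchH T s * (1 - 1 / (s.1 : ℝ)) * M.unmatched n (s.1 - 1, s.2)
    M.lamH / M.totalRate * afterArrival .H + M.lamE / M.totalRate * afterArrival .E

/-- Probability that an `H` agent who arrives when the market is distributed according to `π` waits
(departure time minus arrival time) longer than `t`: she is not matched upon arrival, and she is
not matched by any of the arrivals, Poisson with mean `totalRate * t` in number, within time `t`
after her own arrival. -/
noncomputable def waitTailH (M : Market) (π : PMF MarketState) (t : ℝ) : ℝ≥0∞ :=
  ∑' s, π s * ENNReal.ofReal (M.join .H s) *
    ∑' n : ℕ, ENNReal.ofReal (Real.exp (-(M.totalRate * t)) * (M.totalRate * t) ^ n / (n ! : ℝ)) *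
      ENNReal.ofReal (M.unmatched n (s.add .H))

/-- Average waiting time of an `H` agent who arrives when the market is distributed according
to `π`, i.e. the expectation of the waiting time, as the integral of its tail. -/
noncomputable def meanWaitH (M : Market) (π : PMF MarketState) : ℝ≥0∞ :=
  ∫⁻ t in Ioi (0 : ℝ), M.waitTailH π t

end Market

/-!
Every arrival changes the state of the market, so the steady states are the stationary
distributions of the jump chain observed at the arrivals. Existence follows from the drift of
`(h + e) ^ 2` towards the origin, by extracting a limit of the occupation measures (which the drift
keeps tight); uniqueness, from the fact that the empty market can be reached from every state.

Let `u n` be the mean number of `H` agents present in steady state whom the next `n` arrivals leave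
unmatched. By stationarity `u n - u (n + 1)` is the probability that the next arrival is an `H`
agent who joins the market and is still there `n` arrivals later. As `u n` tends to `0`, summing
over `n` yields Little's law: the average waiting time is the mean of `h` divided by `lamH`.

An arriving `H` agent meets no match among `h` waiting `H` agents with probability
`(1 - pH ^ 2) ^ h = exp (-decay * h)`. The waiting `E` agents contribute only `O(1 / pH)` to the
drift of a quadratic Lyapunov function, which is negligible at the scale `1 / decay ~ 1 / pH ^ 2`
of `h`. Hence `decay * h` concentrates at `log⁺ (2 * lamH / (lamH + lamE))`, below which the drift
of `h` is positive and above which it is negative, and the scaled waiting time tends to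
`log⁺ (2 * l / (l + c)) / l`, where `l = lamH` and `c = lamE`. For `l > c` the derivative of this
limit has the sign of `1 - (y + 1) * log (2 - 2 / (y + 1))` with `y = l / c`, an expression that is
strictly decreasing in `y ≥ 1`.
-/

namespace CountableChain

variable {S : Type*} {K : S → PMF S}

/-- The measure `π` transported by one step of the chain with transition probabilities `K`. It is
`PMF.bind` for measures of arbitrary mass. -/
noncomputable def push (K : S → PMF S) (π : S → ℝ≥0∞) (s : S) : ℝ≥0∞ := ∑' s', π s' * K s' s

theorem tsum_push_mul (K : S → PMF S) (π f : S → ℝ≥0∞) :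
    ∑' s, push K π s * f s = ∑' s, π s * ∑' s', K s s' * f s' := by
  simp only [push, ← ENNReal.tsum_mul_right, ← ENNReal.tsum_mul_left]
  rw [ENNReal.tsum_comm]
  simp only [mul_assoc]

theorem tsum_push (K : S → PMF S) (π : S → ℝ≥0∞) : ∑' s, push K π s = ∑' s, π s := by
  simpa [PMF.tsum_coe] using tsum_push_mul K π 1

theorem push_mono (K : S → PMF S) : Monotone (push K) := fun _ _ h _ =>
  ENNReal.tsum_le_tsum fun s' => mul_le_mul_left (h s') _

theorem push_eq_of_push_le {π : S → ℝ≥0∞} (hle : push K π ≤ π) (hfin : ∑' s, π s ≠ ∞) :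
    push K π = π := by
  by_contra hne
  obtain ⟨-, s, hs⟩ := Pi.lt_def.1 (lt_of_le_of_ne hle hne)
  exact (ENNReal.tsum_lt_tsum (by rwa [tsum_push]) hle hs).ne (tsum_push K π)

section Uniqueness

theorem lt_of_step {π ρ : S → ℝ≥0∞} (hπ : push K π = π) (hρ : push K ρ = ρ) (hle : π ≤ ρ)
    (hfin : ∑' s, π s ≠ ∞) {s s' : S} (hs : π s < ρ s) (hK : K s s' ≠ 0) : π s' < ρ s' := by
  have hπs' : push K π s' ≠ ∞ := by
    rw [hπ]
    exact ENNReal.ne_top_of_tsum_ne_top hfin s'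
  rw [← hπ, ← hρ]
  exact ENNReal.tsum_lt_tsum hπs' (fun t => mul_le_mul_left (hle t) _)
    (ENNReal.mul_lt_mul_left hK ((K s).apply_ne_top s') hs)

theorem ne_zero_of_step {π : S → ℝ≥0∞} (hπ : push K π = π) {s s' : S} (hs : π s ≠ 0)
    (hK : K s s' ≠ 0) : π s' ≠ 0 := by
  rw [← hπ]
  exact fun h => mul_ne_zero hs hK (ENNReal.tsum_eq_zero.1 h s)

theorem push_inf_eq {π ρ : S → ℝ≥0∞} (hπ : push K π = π) (hρ : push K ρ = ρ)
    (hfin : ∑' s, π s ≠ ∞) : push K (π ⊓ ρ) = π ⊓ ρ :=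
  push_eq_of_push_le
    (le_inf ((push_mono K inf_le_left).trans hπ.le) ((push_mono K inf_le_right).trans hρ.le))
    (ne_top_of_le_ne_top hfin (ENNReal.tsum_le_tsum fun _ => inf_le_left))

/-- A set of states which the chain with transition probabilities `K` never leaves. -/
def IsAbsorbing (K : S → PMF S) (C : Set S) : Prop := ∀ s ∈ C, ∀ s', K s s' ≠ 0 → s' ∈ C

theorem exists_apply_lt_of_ne {μ ν : PMF S} (hne : μ ≠ ν) : ∃ s, ν s < μ s := by
  by_contra! hle
  obtain ⟨s, hs⟩ := DFunLike.ne_iff.1 hne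
  refine (ENNReal.tsum_lt_tsum μ.tsum_coe_ne_top hle (lt_of_le_of_ne (hle s) hs)).ne ?_
  rw [μ.tsum_coe, ν.tsum_coe]

theorem apply_lt_of_ne_of_stationary {s₀ : S}
    (hs₀ : ∀ C : Set S, C.Nonempty → IsAbsorbing K C → s₀ ∈ C) {μ ν : PMF S}
    (hμ : push K μ = μ) (hν : push K ν = ν) (hne : μ ≠ ν) : ν s₀ < μ s₀ := by
  have hmin := push_inf_eq hμ hν μ.tsum_coe_ne_top
  have hfin : ∑' s, ((μ : S → ℝ≥0∞) ⊓ ν) s ≠ ∞ :=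
    ne_top_of_le_ne_top μ.tsum_coe_ne_top (ENNReal.tsum_le_tsum fun _ => inf_le_left)
  obtain ⟨s, hs⟩ := exists_apply_lt_of_ne hne
  have h₀ : s₀ ∈ {s | ((μ : S → ℝ≥0∞) ⊓ ν) s < μ s} :=
    hs₀ _ ⟨s, inf_lt_left.2 hs.not_ge⟩ fun _ ht _ hK =>
      lt_of_step hmin hμ inf_le_left hfin ht hK
  exact not_le.1 (inf_lt_left.1 h₀)

theorem stationary_unique {s₀ : S} (hs₀ : ∀ C : Set S, C.Nonempty → IsAbsorbing K C → s₀ ∈ C)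
    {μ ν : PMF S} (hμ : push K μ = μ) (hν : push K ν = ν) : μ = ν :=
  by_contra fun hne => (apply_lt_of_ne_of_stationary hs₀ hμ hν hne).not_gt
    (apply_lt_of_ne_of_stationary hs₀ hν hμ (Ne.symm hne))

end Uniqueness

section Drift

/-- The Foster–Lyapunov drift condition: in one step from `s`, the mean of `V` grows by at most
`b - g s`. -/
def HasDrift (K : S → PMF S) (V g : S → ℝ≥0∞) (b : ℝ≥0∞) : Prop :=
  ∀ s, ∑' s', K s s' * V s' + g s ≤ V s + b

variable {V g : S → ℝ≥0∞} {b : ℝ≥0∞}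

theorem HasDrift.tsum_push_add_le (h : HasDrift K V g b) (μ : PMF S) :
    ∑' s, push K μ s * V s + ∑' s, μ s * g s ≤ ∑' s, μ s * V s + b := by
  rw [tsum_push_mul, ← ENNReal.tsum_add]
  calc ∑' s, (μ s * ∑' s', K s s' * V s' + μ s * g s)
      ≤ ∑' s, (μ s * V s + μ s * b) := by
        refine ENNReal.tsum_le_tsum fun s => ?_
        rw [← mul_add, ← mul_add]
        exact mul_le_mul_right (h s) (μ s)
    _ = ∑' s, μ s * V s + b := by
        rw [ENNReal.tsum_add, ENNReal.tsum_mul_right, μ.tsum_coe, one_mul]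

theorem HasDrift.truncate (h : HasDrift K V g b) (k : ℝ≥0∞) :
    HasDrift K (fun s => min (V s) k) ({s | V s ≤ k}.indicator g) b := by
  intro s
  by_cases hs : V s ≤ k
  · have hmem : s ∈ {s | V s ≤ k} := hs
    simp only [indicator_of_mem hmem, min_eq_left hs]
    calc ∑' s', K s s' * min (V s') k + g s ≤ ∑' s', K s s' * V s' + g s := by
          gcongr with s'
          exact min_le_left _ _
      _ ≤ V s + b := h s
  · have hmem : s ∉ {s | V s ≤ k} := hs
    simp only [indicator_of_notMem hmem, min_eq_right (not_le.1 hs).le, add_zero]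
    calc ∑' s', K s s' * min (V s') k ≤ ∑' s', K s s' * k := by
          gcongr
          exact min_le_right _ _
      _ = k := by rw [ENNReal.tsum_mul_right, (K s).tsum_coe, one_mul]
      _ ≤ k + b := le_self_add

theorem HasDrift.tsum_mul_indicator_le (h : HasDrift K V g b) {μ : PMF S} (hμ : push K μ = μ)
    {k : ℝ≥0∞} (hk : k ≠ ∞) : ∑' s, μ s * {s | V s ≤ k}.indicator g s ≤ b := by
  have hfin : ∑' s, μ s * min (V s) k ≠ ∞ := by
    refine ne_top_of_le_ne_top hk ?_
    calc ∑' s, μ s * min (V s) k ≤ ∑' s, μ s * k := by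
          gcongr
          exact min_le_right _ _
      _ = k := by rw [ENNReal.tsum_mul_right, μ.tsum_coe, one_mul]
  have hdrift := (h.truncate k).tsum_push_add_le μ
  rw [hμ] at hdrift
  exact (ENNReal.add_le_add_iff_left hfin).1 hdrift

/-- `V` need not be integrable under `μ`: the bound passes to the limit from truncations of `V`. -/
theorem HasDrift.tsum_mul_le (h : HasDrift K V g b) (hV : ∀ s, V s ≠ ∞) {μ : PMF S}
    (hμ : push K μ = μ) : ∑' s, μ s * g s ≤ b := by
  rw [ENNReal.tsum_eq_iSup_sum]
  refine iSup_le fun F => ?_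
  have hk : ∑ s ∈ F, V s ≠ ∞ := ENNReal.sum_ne_top.2 fun s _ => hV s
  calc ∑ s ∈ F, μ s * g s = ∑ s ∈ F, μ s * {s | V s ≤ ∑ t ∈ F, V t}.indicator g s :=
        Finset.sum_congr rfl fun s hs => by
          have hmem : s ∈ {s | V s ≤ ∑ t ∈ F, V t} :=
            Finset.single_le_sum_of_canonicallyOrdered (f := V) hs
          rw [indicator_of_mem hmem]
    _ ≤ ∑' s, μ s * {s | V s ≤ ∑ t ∈ F, V t}.indicator g s := ENNReal.sum_le_tsum F
    _ ≤ b := h.tsum_mul_indicator_le hμ hk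

end Drift

section Existence

/-- The distribution after `n` steps of the chain started in `s₀`. -/
noncomputable def law (K : S → PMF S) (s₀ : S) : ℕ → PMF S
  | 0 => PMF.pure s₀
  | n + 1 => (law K s₀ n).bind K

/-- The expected proportion of the times `0, …, N` spent in each state by the chain started in
`s₀`. -/
noncomputable def occupation (K : S → PMF S) (s₀ : S) (N : ℕ) (s : S) : ℝ≥0∞ :=
  (N + 1 : ℝ≥0∞)⁻¹ * ∑ n ∈ Finset.range (N + 1), law K s₀ n s

variable {s₀ : S} {V g : S → ℝ≥0∞} {b : ℝ≥0∞}

theorem tsum_law_zero_mul (K : S → PMF S) (s₀ : S) (f : S → ℝ≥0∞) :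
    ∑' s, law K s₀ 0 s * f s = f s₀ := by
  rw [tsum_eq_single s₀ fun s hs => by simp [law, hs]]
  simp [law]

theorem tsum_law_mul_add_sum_le (h : HasDrift K V g b) (N : ℕ) :
    ∑' s, law K s₀ N s * V s + ∑ n ∈ Finset.range N, ∑' s, law K s₀ n s * g s
      ≤ V s₀ + N * b := by
  induction N with
  | zero => simp [tsum_law_zero_mul]
  | succ N ih =>
    have hstep := h.tsum_push_add_le (law K s₀ N)
    calc ∑' s, law K s₀ (N + 1) s * V s + ∑ n ∈ Finset.range (N + 1), ∑' s, law K s₀ n s * g s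
        = (∑' s, push K (law K s₀ N) s * V s + ∑' s, law K s₀ N s * g s) +
            ∑ n ∈ Finset.range N, ∑' s, law K s₀ n s * g s := by
          rw [Finset.sum_range_succ, add_comm (∑ n ∈ _, _), ← add_assoc]
          rfl
      _ ≤ (∑' s, law K s₀ N s * V s + b) + ∑ n ∈ Finset.range N, ∑' s, law K s₀ n s * g s := by
          gcongr
      _ = (∑' s, law K s₀ N s * V s + ∑ n ∈ Finset.range N, ∑' s, law K s₀ n s * g s) + b := by
          ring
      _ ≤ (V s₀ + N * b) + b := by gcongr
      _ = V s₀ + (N + 1 : ℕ) * b := by push_cast; ring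

theorem tsum_occupation_mul (K : S → PMF S) (s₀ : S) (N : ℕ) (f : S → ℝ≥0∞) :
    ∑' s, occupation K s₀ N s * f s =
      (N + 1 : ℝ≥0∞)⁻¹ * ∑ n ∈ Finset.range (N + 1), ∑' s, law K s₀ n s * f s := by
  rw [← Summable.tsum_finsetSum fun _ _ => ENNReal.summable, ← ENNReal.tsum_mul_left]
  refine tsum_congr fun s => ?_
  rw [occupation, ← Finset.sum_mul, mul_assoc]

theorem tsum_occupation (K : S → PMF S) (s₀ : S) (N : ℕ) : ∑' s, occupation K s₀ N s = 1 := by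
  have h := tsum_occupation_mul K s₀ N 1
  simp only [Pi.one_apply, mul_one, PMF.tsum_coe, Finset.sum_const, Finset.card_range,
    nsmul_eq_mul] at h
  rw [h]
  push_cast
  exact ENNReal.inv_mul_cancel (by simp) (by simp)

theorem tsum_occupation_mul_le (h : HasDrift K V g b) (N : ℕ) :
    ∑' s, occupation K s₀ N s * g s ≤ V s₀ + b := by
  rw [tsum_occupation_mul, mul_comm, ← div_eq_mul_inv]
  refine ENNReal.div_le_of_le_mul ?_
  calc ∑ n ∈ Finset.range (N + 1), ∑' s, law K s₀ n s * g s
      ≤ V s₀ + (N + 1 : ℕ) * b := le_add_self.trans (tsum_law_mul_add_sum_le h (N + 1))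
    _ ≤ V s₀ * (N + 1) + b * (N + 1) := by
        push_cast
        rw [mul_comm _ b]
        gcongr
        exact le_mul_of_one_le_right zero_le le_add_self
    _ = (V s₀ + b) * (N + 1) := (add_mul _ _ _).symm

theorem push_occupation_le (K : S → PMF S) (s₀ : S) (N : ℕ) (s : S) :
    push K (occupation K s₀ N) s ≤ occupation K s₀ N s + (N + 1 : ℝ≥0∞)⁻¹ := by
  have hshift : ∑ n ∈ Finset.range (N + 1), law K s₀ (n + 1) s ≤
      ∑ n ∈ Finset.range (N + 1), law K s₀ n s + 1 := by
    calc ∑ n ∈ Finset.range (N + 1), law K s₀ (n + 1) s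
        ≤ ∑ n ∈ Finset.range (N + 1), law K s₀ (n + 1) s + law K s₀ 0 s := le_self_add
      _ = ∑ n ∈ Finset.range (N + 1), law K s₀ n s + law K s₀ (N + 1) s := by
          rw [← Finset.sum_range_succ' fun n => law K s₀ n s, Finset.sum_range_succ]
      _ ≤ ∑ n ∈ Finset.range (N + 1), law K s₀ n s + 1 := by
          gcongr
          exact PMF.coe_le_one _ s
  calc push K (occupation K s₀ N) s
      = (N + 1 : ℝ≥0∞)⁻¹ * ∑ n ∈ Finset.range (N + 1), law K s₀ (n + 1) s :=
        tsum_occupation_mul K s₀ N fun s' => K s' s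
    _ ≤ (N + 1 : ℝ≥0∞)⁻¹ * (∑ n ∈ Finset.range (N + 1), law K s₀ n s + 1) := by gcongr
    _ = occupation K s₀ N s + (N + 1 : ℝ≥0∞)⁻¹ := by rw [mul_add, mul_one, occupation]

variable {ι : Type*} {l : Filter ι} [l.NeBot] {ν : ι → S → ℝ≥0∞} {π : S → ℝ≥0∞}

theorem tsum_mul_le_of_tendsto {f : S → ℝ≥0∞} {c : ι → ℝ≥0∞} {c₀ : ℝ≥0∞}
    (hν : Tendsto ν l (𝓝 π)) (hf : ∀ s, f s ≠ ∞) (hc : Tendsto c l (𝓝 c₀))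
    (hle : ∀ i, ∑' s, ν i s * f s ≤ c i) : ∑' s, π s * f s ≤ c₀ := by
  rw [ENNReal.tsum_eq_iSup_sum]
  refine iSup_le fun F => le_of_tendsto_of_tendsto' (tendsto_finsetSum F fun s _ =>
    ENNReal.Tendsto.mul_const (tendsto_pi_nhds.1 hν s) (Or.inr (hf s))) hc fun i => ?_
  exact (ENNReal.sum_le_tsum F).trans (hle i)

theorem tsum_le_sum_add_of_le_compl {p g : S → ℝ≥0∞} {F : Finset S} {c : ℝ≥0∞} (hc₀ : c ≠ 0)
    (hc : c ≠ ∞) (hF : ∀ s ∉ F, c ≤ g s) :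
    ∑' s, p s ≤ ∑ s ∈ F, p s + (∑' s, p s * g s) * c⁻¹ := by
  classical
  calc ∑' s, p s ≤ ∑' s, ((if s ∈ F then p s else 0) + p s * g s * c⁻¹) := by
        refine ENNReal.tsum_le_tsum fun s => ?_
        split_ifs with hs
        · exact le_self_add
        · rw [zero_add, mul_assoc]
          refine le_mul_of_one_le_right zero_le ?_
          rw [← ENNReal.mul_inv_cancel hc₀ hc]
          gcongr
          exact hF s hs
    _ = ∑ s ∈ F, p s + (∑' s, p s * g s) * c⁻¹ := by
        rw [ENNReal.tsum_add, ENNReal.tsum_mul_right,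
          tsum_eq_sum (s := F) fun s hs => if_neg hs]
        congr 1
        exact Finset.sum_congr rfl fun s hs => if_pos hs

theorem tendsto_natCast_add_one_inv_nhds_zero :
    Tendsto (fun N : ℕ => (N + 1 : ℝ≥0∞)⁻¹) atTop (𝓝 0) := by
  refine (ENNReal.tendsto_inv_nat_nhds_zero.comp (tendsto_add_atTop_nat 1)).congr fun N => ?_
  simp

/-- Tightness: no mass escapes to infinity. -/
theorem one_le_tsum_of_tendsto {B : ℝ≥0∞} (hν : Tendsto ν l (𝓝 π)) (hν₁ : ∀ i, ∑' s, ν i s = 1)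
    (hg : ∀ c : ℕ, {s | g s ≤ c}.Finite) (hB : B ≠ ∞) (hνg : ∀ i, ∑' s, ν i s * g s ≤ B) :
    1 ≤ ∑' s, π s := by
  have hbound : ∀ c : ℕ, 1 ≤ ∑' s, π s + B * (c + 1 : ℝ≥0∞)⁻¹ := by
    intro c
    set F := (hg (c + 1)).toFinset
    have hF : ∀ s ∉ F, (c + 1 : ℝ≥0∞) ≤ g s := fun s hs => by
      simp only [F, Finite.mem_toFinset, mem_ofPred_eq, not_le] at hs
      exact_mod_cast hs.le
    have hνF : ∀ i, 1 ≤ ∑ s ∈ F, ν i s + B * (c + 1 : ℝ≥0∞)⁻¹ := fun i => by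
      refine (hν₁ i).ge.trans
        ((tsum_le_sum_add_of_le_compl (by simp) (by finiteness) hF).trans ?_)
      gcongr
      exact hνg i
    have hlim : 1 ≤ ∑ s ∈ F, π s + B * (c + 1 : ℝ≥0∞)⁻¹ :=
      ge_of_tendsto' ((tendsto_finsetSum F fun s _ => tendsto_pi_nhds.1 hν s).add_const _) hνF
    refine hlim.trans ?_
    gcongr
    exact ENNReal.sum_le_tsum F
  have hinv := (ENNReal.Tendsto.const_mul tendsto_natCast_add_one_inv_nhds_zero
    (Or.inr hB)).const_add (∑' s, π s)
  rw [mul_zero, add_zero] at hinv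
  exact ge_of_tendsto' hinv hbound

/-- Krylov–Bogoliubov: a limit of the occupation measures along an ultrafilter is stationary. -/
theorem exists_stationary [Nonempty S] (h : HasDrift K V g b) (hV : ∀ s, V s ≠ ∞) (hb : b ≠ ∞)
    (hg : ∀ c : ℕ, {s | g s ≤ c}.Finite) : ∃ μ : PMF S, push K μ = μ := by
  obtain ⟨s₀⟩ := ‹Nonempty S›
  let U : Ultrafilter ℕ := hyperfilter ℕ
  obtain ⟨π, -, hπ⟩ := isCompact_univ.ultrafilter_le_nhds (U.map (occupation K s₀)) (by simp)
  replace hπ : Tendsto (occupation K s₀) U (𝓝 π) := hπ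
  have hle : ∑' s, π s ≤ 1 := by
    simpa using tsum_mul_le_of_tendsto (f := 1) hπ (by simp) tendsto_const_nhds
      fun N => by simp [tsum_occupation]
  have hge : 1 ≤ ∑' s, π s := one_le_tsum_of_tendsto hπ (tsum_occupation K s₀) hg
    (ENNReal.add_ne_top.2 ⟨hV s₀, hb⟩) (tsum_occupation_mul_le h)
  have hπ₁ : ∑' s, π s = 1 := le_antisymm hle hge
  have hpush : push K π ≤ π := fun s => by
    have hlim := (tendsto_pi_nhds.1 hπ s).add
      (tendsto_natCast_add_one_inv_nhds_zero.mono_left Nat.hyperfilter_le_atTop)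
    rw [add_zero] at hlim
    exact tsum_mul_le_of_tendsto hπ (fun s' => (K s').apply_ne_top s) hlim
      fun N => push_occupation_le K s₀ N s
  exact ⟨⟨π, hπ₁ ▸ ENNReal.summable.hasSum⟩,
    push_eq_of_push_le hpush (ne_top_of_le_ne_top ENNReal.one_ne_top hle)⟩

end Existence

end CountableChain

namespace MarketState

theorem add_H_eq_succ_iff {s : MarketState} {h e : ℕ} : s.add .H = (h + 1, e) ↔ s = (h, e) := by
  simp [add, Prod.ext_iff]

theorem add_E_eq_succ_iff {s : MarketState} {h e : ℕ} : s.add .E = (h, e + 1) ↔ s = (h, e) := by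
  simp [add, Prod.ext_iff]

theorem add_fst_add_snd (s : MarketState) (T : AgentType) :
    ((s.add T).1 + (s.add T).2 : ℝ) = s.1 + s.2 + 1 := by
  cases T <;> simp only [add] <;> push_cast <;> ring

end MarketState

theorem hasSum_ite_eq_mul {S : Type*} [DecidableEq S] (s₀ : S) (c : ℝ) (f : S → ℝ) :
    HasSum (fun s => (if s = s₀ then c else 0) * f s) (c * f s₀) := by
  refine (hasSum_ite_eq s₀ (c * f s₀)).congr_fun fun s => ?_
  split_ifs with hs
  · rw [hs]
  · rw [zero_mul]

theorem one_sub_pow_mul_le_inv {q : ℝ} (hq₀ : 0 < q) (hq₁ : q ≤ 1) (n : ℕ) :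
    (1 - q) ^ n * n ≤ q⁻¹ := by
  have hpow : 0 ≤ (1 - q) ^ n := pow_nonneg (by linarith) n
  have hbernoulli : 1 + n * q ≤ (1 + q) ^ n := one_add_mul_le_pow (by linarith) n
  have hone : (1 - q) ^ n * (1 + q) ^ n ≤ 1 := by
    rw [← mul_pow]
    exact pow_le_one₀ (by nlinarith) (by nlinarith)
  rw [← one_div, le_div_iff₀ hq₀]
  calc (1 - q) ^ n * n * q ≤ (1 - q) ^ n * (1 + n * q) := by linarith
    _ ≤ (1 - q) ^ n * (1 + q) ^ n := by gcongr
    _ ≤ 1 := hone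

section PoissonProcess

open MeasureTheory ProbabilityTheory

theorem lintegral_poisson_pmf {r : ℝ} (hr : 0 < r) (n : ℕ) :
    ∫⁻ t in Ioi (0 : ℝ), ENNReal.ofReal (Real.exp (-(r * t)) * (r * t) ^ n / (n ! : ℝ)) =
      ENNReal.ofReal r⁻¹ := by
  have hgamma : ∀ t ∈ Ioi (0 : ℝ),
      ENNReal.ofReal (Real.exp (-(r * t)) * (r * t) ^ n / (n ! : ℝ)) =
        ENNReal.ofReal r⁻¹ * gammaPDF (n + 1 : ℕ) r t := by
    intro t ht
    rw [gammaPDF_of_nonneg (le_of_lt ht), ← ENNReal.ofReal_mul (inv_nonneg.2 hr.le)]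
    push_cast
    rw [Real.Gamma_nat_eq_factorial, add_sub_cancel_right, Real.rpow_natCast, ← Nat.cast_add_one,
      Real.rpow_natCast, mul_pow, pow_succ]
    congr 1
    field_simp
  have htotal : ∫⁻ t in Ioi (0 : ℝ), gammaPDF (n + 1 : ℕ) r t = 1 := by
    have huniv := lintegral_gammaPDF_eq_one (a := (n + 1 : ℕ)) (r := r) (by positivity) hr
    rwa [← lintegral_add_compl _ (measurableSet_Ioi (a := (0 : ℝ))), compl_Ioi,
      ← setLIntegral_congr Iio_ae_eq_Iic, lintegral_gammaPDF_of_nonpos le_rfl, add_zero] at huniv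
  rw [setLIntegral_congr_fun measurableSet_Ioi hgamma,
    lintegral_const_mul' _ _ ENNReal.ofReal_ne_top, htotal, mul_one]

end PoissonProcess

namespace Market

open CountableChain

/-- The ranges of the parameters: positive rates, `pH ∈ (0, 1)` and `pE ∈ (0, 1]`. -/
structure Admissible (M : Market) : Prop where
  lamH_pos : 0 < M.lamH
  lamE_pos : 0 < M.lamE
  pH_pos : 0 < M.pH
  pH_lt_one : M.pH < 1
  pE_pos : 0 < M.pE
  pE_le_one : M.pE ≤ 1

/-- The expectation of `f` at the state reached from `s` by the arrival of a `T` agent. The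
truncated subtractions are harmless: where they truncate, the probability of the match is `0`. -/
noncomputable def afterArrival (M : Market) (f : MarketState → ℝ) (T : AgentType)
    (s : MarketState) : ℝ :=
  M.join T s * f (s.add T) + M.matchE T s * f (s.1, s.2 - 1) + M.matchH T s * f (s.1 - 1, s.2)

/-- The expectation of `f` at the state reached from `s` by the next arrival, i.e. the transition
operator of the jump chain. -/
noncomputable def expectNext (M : Market) (f : MarketState → ℝ) (s : MarketState) : ℝ :=
  M.lamH / M.totalRate * M.afterArrival f .H s + M.lamE / M.totalRate * M.afterArrival f .E s

variable {M : Market}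

theorem matchH_zero (T : AgentType) (e : ℕ) : M.matchH T (0, e) = 0 := by simp [matchH]

theorem matchE_zero (T : AgentType) (h : ℕ) : M.matchE T (h, 0) = 0 := by simp [matchE]

theorem join_add_matchE_add_matchH (M : Market) (T : AgentType) (s : MarketState) :
    M.join T s + M.matchE T s + M.matchH T s = 1 := by
  unfold join matchE matchH
  ring

namespace Admissible

theorem totalRate_pos (hM : M.Admissible) : 0 < M.totalRate := add_pos hM.lamH_pos hM.lamE_pos

theorem lamH_div_totalRate_pos (hM : M.Admissible) : 0 < M.lamH / M.totalRate :=
  div_pos hM.lamH_pos hM.totalRate_pos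

theorem lamE_div_totalRate_pos (hM : M.Admissible) : 0 < M.lamE / M.totalRate :=
  div_pos hM.lamE_pos hM.totalRate_pos

theorem lamH_div_add_lamE_div (hM : M.Admissible) :
    M.lamH / M.totalRate + M.lamE / M.totalRate = 1 := by
  rw [← add_div]
  exact div_self hM.totalRate_pos.ne'

theorem lam_pos (hM : M.Admissible) (T : AgentType) : 0 < M.lam T := by
  cases T
  exacts [hM.lamH_pos, hM.lamE_pos]

theorem p_pos (hM : M.Admissible) (T : AgentType) : 0 < M.p T := by
  cases T
  exacts [hM.pH_pos, hM.pE_pos]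

theorem p_le_one (hM : M.Admissible) (T : AgentType) : M.p T ≤ 1 := by
  cases T
  exacts [hM.pH_lt_one.le, hM.pE_le_one]

theorem p_mul_pH_pos (hM : M.Admissible) (T : AgentType) : 0 < M.p T * M.pH :=
  mul_pos (hM.p_pos T) hM.pH_pos

theorem p_mul_pH_lt_one (hM : M.Admissible) (T : AgentType) : M.p T * M.pH < 1 :=
  mul_lt_one_of_nonneg_of_lt_one_right (hM.p_le_one T) hM.pH_pos.le hM.pH_lt_one

theorem p_mul_pE_pos (hM : M.Admissible) (T : AgentType) : 0 < M.p T * M.pE :=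
  mul_pos (hM.p_pos T) hM.pE_pos

theorem p_mul_pE_le_one (hM : M.Admissible) (T : AgentType) : M.p T * M.pE ≤ 1 :=
  mul_le_one₀ (hM.p_le_one T) hM.pE_pos.le hM.pE_le_one

theorem one_sub_p_mul_pH_pow_pos (hM : M.Admissible) (T : AgentType) (n : ℕ) :
    0 < (1 - M.p T * M.pH) ^ n :=
  pow_pos (sub_pos.2 (hM.p_mul_pH_lt_one T)) n

theorem one_sub_p_mul_pH_pow_le_one (hM : M.Admissible) (T : AgentType) (n : ℕ) :
    (1 - M.p T * M.pH) ^ n ≤ 1 :=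
  pow_le_one₀ (sub_nonneg.2 (hM.p_mul_pH_lt_one T).le) (sub_le_self _ (hM.p_mul_pH_pos T).le)

theorem one_sub_p_mul_pE_pow_nonneg (hM : M.Admissible) (T : AgentType) (n : ℕ) :
    0 ≤ (1 - M.p T * M.pE) ^ n :=
  pow_nonneg (sub_nonneg.2 (hM.p_mul_pE_le_one T)) n

theorem one_sub_p_mul_pE_pow_le_one (hM : M.Admissible) (T : AgentType) (n : ℕ) :
    (1 - M.p T * M.pE) ^ n ≤ 1 :=
  pow_le_one₀ (sub_nonneg.2 (hM.p_mul_pE_le_one T)) (sub_le_self _ (hM.p_mul_pE_pos T).le)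

theorem matchH_nonneg (hM : M.Admissible) (T : AgentType) (s : MarketState) : 0 ≤ M.matchH T s :=
  sub_nonneg.2 (hM.one_sub_p_mul_pH_pow_le_one T _)

theorem matchE_nonneg (hM : M.Admissible) (T : AgentType) (s : MarketState) : 0 ≤ M.matchE T s :=
  mul_nonneg (hM.one_sub_p_mul_pH_pow_pos T _).le
    (sub_nonneg.2 (hM.one_sub_p_mul_pE_pow_le_one T _))

theorem join_nonneg (hM : M.Admissible) (T : AgentType) (s : MarketState) : 0 ≤ M.join T s :=
  mul_nonneg (hM.one_sub_p_mul_pH_pow_pos T _).le (hM.one_sub_p_mul_pE_pow_nonneg T _)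

theorem join_H_pos (hM : M.Admissible) (s : MarketState) : 0 < M.join .H s := by
  have hHE : M.p .H * M.pE < 1 := mul_comm M.pE M.pH ▸ hM.p_mul_pH_lt_one .E
  exact mul_pos (hM.one_sub_p_mul_pH_pow_pos .H _) (pow_pos (sub_pos.2 hHE) _)

theorem matchH_succ_pos (hM : M.Admissible) (T : AgentType) (h e : ℕ) :
    0 < M.matchH T (h + 1, e) :=
  sub_pos.2 (pow_lt_one₀ (sub_nonneg.2 (hM.p_mul_pH_lt_one T).le)
    (sub_lt_self _ (hM.p_mul_pH_pos T)) h.succ_ne_zero)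

theorem matchE_succ_pos (hM : M.Admissible) (T : AgentType) (h e : ℕ) :
    0 < M.matchE T (h, e + 1) :=
  mul_pos (hM.one_sub_p_mul_pH_pow_pos T h) (sub_pos.2 (pow_lt_one₀
    (sub_nonneg.2 (hM.p_mul_pE_le_one T)) (sub_lt_self _ (hM.p_mul_pE_pos T)) e.succ_ne_zero))

theorem arrivalRate_nonneg (hM : M.Admissible) (T : AgentType) (s s' : MarketState) :
    0 ≤ M.arrivalRate T s s' := by
  have := hM.join_nonneg T s
  have := hM.matchE_nonneg T s
  have := hM.matchH_nonneg T s
  refine mul_nonneg (hM.lam_pos T).le ?_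
  split_ifs <;> positivity

theorem arrivalRate_le_rate (hM : M.Admissible) (T : AgentType) (s s' : MarketState) :
    M.arrivalRate T s s' ≤ M.rate s s' := by
  cases T
  exacts [le_add_of_nonneg_right (hM.arrivalRate_nonneg _ _ _),
    le_add_of_nonneg_left (hM.arrivalRate_nonneg _ _ _)]

theorem rate_nonneg (hM : M.Admissible) (s s' : MarketState) : 0 ≤ M.rate s s' :=
  (hM.arrivalRate_nonneg .H s s').trans (hM.arrivalRate_le_rate .H s s')

theorem afterArrival_mono (hM : M.Admissible) {f g : MarketState → ℝ} (hfg : f ≤ g)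
    (T : AgentType) (s : MarketState) : M.afterArrival f T s ≤ M.afterArrival g T s := by
  have := hM.join_nonneg T s
  have := hM.matchE_nonneg T s
  have := hM.matchH_nonneg T s
  unfold afterArrival
  gcongr <;> exact hfg _

theorem expectNext_le (hM : M.Admissible) {f : MarketState → ℝ} {s : MarketState} {cH cE : ℝ}
    (hH : M.afterArrival f .H s ≤ cH) (hE : M.afterArrival f .E s ≤ cE) :
    M.expectNext f s ≤ M.lamH / M.totalRate * cH + M.lamE / M.totalRate * cE :=
  add_le_add (mul_le_mul_of_nonneg_left hH hM.lamH_div_totalRate_pos.le)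
    (mul_le_mul_of_nonneg_left hE hM.lamE_div_totalRate_pos.le)

theorem expectNext_mono (hM : M.Admissible) {f g : MarketState → ℝ} (hfg : f ≤ g) :
    M.expectNext f ≤ M.expectNext g := fun s =>
  hM.expectNext_le (hM.afterArrival_mono hfg .H s) (hM.afterArrival_mono hfg .E s)

theorem expectNext_const (hM : M.Admissible) (c : ℝ) (s : MarketState) :
    M.expectNext (fun _ => c) s = c := by
  simp only [expectNext, afterArrival, ← add_mul, join_add_matchE_add_matchH, one_mul,
    hM.lamH_div_add_lamE_div]

theorem expectNext_nonneg (hM : M.Admissible) {f : MarketState → ℝ} (hf : ∀ s, 0 ≤ f s)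
    (s : MarketState) : 0 ≤ M.expectNext f s :=
  (hM.expectNext_const 0 s).ge.trans (hM.expectNext_mono hf s)

end Admissible

section JumpChain

theorem hasSum_matchH_mul (f : MarketState → ℝ) (T : AgentType) (s : MarketState) :
    HasSum (fun s' : MarketState => (if s'.add .H = s then M.matchH T s else 0) * f s')
      (M.matchH T s * f (s.1 - 1, s.2)) := by
  obtain ⟨_ | h, e⟩ := s
  · simp [matchH_zero, hasSum_zero]
  · simpa only [MarketState.add_H_eq_succ_iff, Nat.add_sub_cancel] using
      hasSum_ite_eq_mul (h, e) (M.matchH T (h + 1, e)) f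

theorem hasSum_matchE_mul (f : MarketState → ℝ) (T : AgentType) (s : MarketState) :
    HasSum (fun s' : MarketState => (if s'.add .E = s then M.matchE T s else 0) * f s')
      (M.matchE T s * f (s.1, s.2 - 1)) := by
  obtain ⟨h, _ | e⟩ := s
  · simp [matchE_zero, hasSum_zero]
  · simpa only [MarketState.add_E_eq_succ_iff, Nat.add_sub_cancel] using
      hasSum_ite_eq_mul (h, e) (M.matchE T (h, e + 1)) f

theorem hasSum_arrivalRate_mul (f : MarketState → ℝ) (T : AgentType) (s : MarketState) :
    HasSum (fun s' => M.arrivalRate T s s' * f s') (M.lam T * M.afterArrival f T s) := by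
  refine ((((hasSum_ite_eq_mul (s.add T) (M.join T s) f).add (hasSum_matchE_mul f T s)).add
    (hasSum_matchH_mul f T s)).mul_left (M.lam T)).congr_fun fun s' => ?_
  unfold arrivalRate
  ring

theorem hasSum_rate_mul (f : MarketState → ℝ) (s : MarketState) :
    HasSum (fun s' => M.rate s s' / M.totalRate * f s') (M.expectNext f s) := by
  have hsum := ((M.hasSum_arrivalRate_mul f .H s).add (M.hasSum_arrivalRate_mul f .E s)).div_const
    M.totalRate
  have hnext : (M.lam .H * M.afterArrival f .H s + M.lam .E * M.afterArrival f .E s) /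
      M.totalRate = M.expectNext f s := by
    unfold expectNext lam
    ring
  rw [hnext] at hsum
  refine hsum.congr_fun fun s' => ?_
  unfold rate
  ring

namespace Admissible

theorem tsum_ofReal_rate_div_mul (hM : M.Admissible) {f : MarketState → ℝ} (hf : ∀ s, 0 ≤ f s)
    (s : MarketState) :
    ∑' s', ENNReal.ofReal (M.rate s s' / M.totalRate) * ENNReal.ofReal (f s') =
      ENNReal.ofReal (M.expectNext f s) := by
  have hrate : ∀ s', 0 ≤ M.rate s s' / M.totalRate := fun s' =>
    div_nonneg (hM.rate_nonneg _ _) hM.totalRate_pos.le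
  rw [← (M.hasSum_rate_mul f s).tsum_eq, ENNReal.ofReal_tsum_of_nonneg
    (fun s' => mul_nonneg (hrate s') (hf s')) (M.hasSum_rate_mul f s).summable]
  exact tsum_congr fun s' => (ENNReal.ofReal_mul (hrate s')).symm

/-- The transition probabilities of the jump chain, which records the states of the market between
successive arrivals. As every arrival changes the state, it has the stationary distributions of the
continuous-time chain. -/
noncomputable def jump (hM : M.Admissible) (s : MarketState) : PMF MarketState :=
  ⟨fun s' => ENNReal.ofReal (M.rate s s' / M.totalRate), ENNReal.summable.hasSum_iff.2 <| by
    simpa [hM.expectNext_const] using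
      hM.tsum_ofReal_rate_div_mul (f := fun _ => 1) (fun _ => zero_le_one) s⟩

theorem tsum_jump_mul (hM : M.Admissible) {f : MarketState → ℝ} (hf : ∀ s, 0 ≤ f s)
    (s : MarketState) :
    ∑' s', hM.jump s s' * ENNReal.ofReal (f s') = ENNReal.ofReal (M.expectNext f s) :=
  hM.tsum_ofReal_rate_div_mul hf s

theorem ofReal_rate (hM : M.Admissible) (s s' : MarketState) :
    ENNReal.ofReal (M.rate s s') = hM.jump s s' * ENNReal.ofReal M.totalRate := by
  refine Eq.trans ?_ (ENNReal.ofReal_mul (div_nonneg (hM.rate_nonneg _ _) hM.totalRate_pos.le))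
  rw [div_mul_cancel₀ _ hM.totalRate_pos.ne']

theorem isSteadyState_iff (hM : M.Admissible) {μ : PMF MarketState} :
    M.IsSteadyState μ ↔ push hM.jump μ = μ := by
  have hΛ : ENNReal.ofReal M.totalRate ≠ 0 := by simpa using hM.totalRate_pos
  simp only [IsSteadyState, hM.ofReal_rate, ← mul_assoc, ENNReal.tsum_mul_right, push,
    PMF.tsum_coe, mul_one, ENNReal.mul_left_inj hΛ ENNReal.ofReal_ne_top, funext_iff]

theorem jump_ne_zero_of_arrivalRate_pos (hM : M.Admissible) {T : AgentType} {s s' : MarketState}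
    (h : 0 < M.arrivalRate T s s') : hM.jump s s' ≠ 0 :=
  (ENNReal.ofReal_pos.2
    (div_pos (h.trans_le (hM.arrivalRate_le_rate T s s')) hM.totalRate_pos)).ne'

theorem jump_remove_H_ne_zero (hM : M.Admissible) (h e : ℕ) : hM.jump (h + 1, e) (h, e) ≠ 0 := by
  refine hM.jump_ne_zero_of_arrivalRate_pos (T := .H) (mul_pos (hM.lam_pos _) ?_)
  simpa [MarketState.add, add_assoc] using hM.matchH_succ_pos .H h e

theorem jump_remove_E_ne_zero (hM : M.Admissible) (h e : ℕ) : hM.jump (h, e + 1) (h, e) ≠ 0 := by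
  refine hM.jump_ne_zero_of_arrivalRate_pos (T := .E) (mul_pos (hM.lam_pos _) ?_)
  simpa [MarketState.add, add_assoc] using hM.matchE_succ_pos .E h e

theorem empty_mem_of_isAbsorbing (hM : M.Admissible) {C : Set MarketState} (hC : C.Nonempty)
    (habs : IsAbsorbing hM.jump C) : ((0, 0) : MarketState) ∈ C := by
  obtain ⟨⟨h, e⟩, hs⟩ := hC
  have hnoH : ((0, e) : MarketState) ∈ C := by
    induction h with
    | zero => exact hs
    | succ h ih => exact ih (habs _ hs _ (hM.jump_remove_H_ne_zero h e))
  clear hs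
  induction e with
  | zero => exact hnoH
  | succ e ih => exact ih (habs _ hnoH _ (hM.jump_remove_E_ne_zero 0 e))

theorem hasDrift_jump (hM : M.Admissible) {V g : MarketState → ℝ} {b : ℝ} (hV : ∀ s, 0 ≤ V s)
    (hg : ∀ s, 0 ≤ g s) (h : ∀ s, M.expectNext V s + g s ≤ V s + b) :
    HasDrift hM.jump (fun s => ENNReal.ofReal (V s)) (fun s => ENNReal.ofReal (g s))
      (ENNReal.ofReal b) := fun s => by
  rw [hM.tsum_jump_mul hV, ← ENNReal.ofReal_add (hM.expectNext_nonneg hV s) (hg s)]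
  exact (ENNReal.ofReal_le_ofReal (h s)).trans ENNReal.ofReal_add_le

theorem tsum_mul_le_of_drift (hM : M.Admissible) {μ : PMF MarketState} (hμ : M.IsSteadyState μ)
    {V g : MarketState → ℝ} {b : ℝ} (hV : ∀ s, 0 ≤ V s) (hg : ∀ s, 0 ≤ g s)
    (h : ∀ s, M.expectNext V s + g s ≤ V s + b) :
    ∑' s, μ s * ENNReal.ofReal (g s) ≤ ENNReal.ofReal b :=
  (hM.hasDrift_jump hV hg h).tsum_mul_le (fun _ => ENNReal.ofReal_ne_top)
    (hM.isSteadyState_iff.1 hμ)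

end Admissible

end JumpChain

section SteadyState

theorem matchH_mul_cast_pred (T : AgentType) (s : MarketState) (F : ℝ → ℝ) :
    M.matchH T s * F ((s.1 - 1 : ℕ) : ℝ) = M.matchH T s * F (s.1 - 1) := by
  obtain ⟨_ | h, e⟩ := s <;> simp [matchH_zero]

theorem matchE_mul_cast_pred (T : AgentType) (s : MarketState) (F : ℝ → ℝ) :
    M.matchE T s * F ((s.2 - 1 : ℕ) : ℝ) = M.matchE T s * F (s.2 - 1) := by
  obtain ⟨h, _ | e⟩ := s <;> simp [matchE_zero]

theorem afterArrival_cast (F : ℝ → ℝ → ℝ) (T : AgentType) (s : MarketState) :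
    M.afterArrival (fun s => F s.1 s.2) T s =
      M.join T s * F (s.add T).1 (s.add T).2 + M.matchE T s * F s.1 (s.2 - 1) +
        M.matchH T s * F (s.1 - 1) s.2 := by
  unfold afterArrival
  rw [matchE_mul_cast_pred T s (F s.1), matchH_mul_cast_pred T s fun x => F x s.2]

/-- The steady-state distribution of the chain. It is an arbitrary distribution if there is none. -/
noncomputable def steadyState (M : Market) : PMF MarketState := Classical.epsilon M.IsSteadyState

/-- The expected number of waiting `H` agents under the distribution `μ`. -/
noncomputable def meanH (μ : PMF MarketState) : ℝ≥0∞ := ∑' s, μ s * s.1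

namespace Admissible

theorem join_mul_le (hM : M.Admissible) (T : AgentType) (s : MarketState) :
    M.join T s * (s.1 + s.2) ≤ (M.p T * M.pH)⁻¹ + (M.p T * M.pE)⁻¹ := by
  have hH := one_sub_pow_mul_le_inv (hM.p_mul_pH_pos T) (hM.p_mul_pH_lt_one T).le s.1
  have hE := one_sub_pow_mul_le_inv (hM.p_mul_pE_pos T) (hM.p_mul_pE_le_one T) s.2
  have := hM.one_sub_p_mul_pH_pow_pos T s.1
  have := hM.one_sub_p_mul_pE_pow_nonneg T s.2
  calc M.join T s * (s.1 + s.2)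
      = ((1 - M.p T * M.pH) ^ s.1 * s.1) * (1 - M.p T * M.pE) ^ s.2 +
        (1 - M.p T * M.pH) ^ s.1 * ((1 - M.p T * M.pE) ^ s.2 * s.2) := by
        unfold join
        ring
    _ ≤ ((1 - M.p T * M.pH) ^ s.1 * s.1) * 1 + 1 * ((1 - M.p T * M.pE) ^ s.2 * s.2) := by
        gcongr
        exacts [hM.one_sub_p_mul_pE_pow_le_one T s.2, hM.one_sub_p_mul_pH_pow_le_one T s.1]
    _ ≤ (M.p T * M.pH)⁻¹ + (M.p T * M.pE)⁻¹ := by linarith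

theorem afterArrival_sq_le (hM : M.Admissible) (T : AgentType) (s : MarketState) :
    M.afterArrival (fun s => ((s.1 : ℝ) + s.2) ^ 2) T s ≤
      (s.1 + s.2 : ℝ) ^ 2 - 2 * (s.1 + s.2) +
        (1 + 4 * ((M.p T * M.pH)⁻¹ + (M.p T * M.pE)⁻¹)) := by
  have hjoin := hM.join_mul_le T s
  have hsum := M.join_add_matchE_add_matchH T s
  rw [afterArrival_cast fun x y => (x + y) ^ 2, s.add_fst_add_snd T,
    show M.matchE T s = 1 - M.join T s - M.matchH T s by linarith]
  linarith

theorem exists_drift_sq (hM : M.Admissible) : ∃ b : ℝ, ∀ s : MarketState,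
    M.expectNext (fun s => ((s.1 : ℝ) + s.2) ^ 2) s + 2 * (s.1 + s.2 : ℝ) ≤
      (s.1 + s.2 : ℝ) ^ 2 + b := by
  let b (T : AgentType) : ℝ := 1 + 4 * ((M.p T * M.pH)⁻¹ + (M.p T * M.pE)⁻¹)
  refine ⟨M.lamH / M.totalRate * b .H + M.lamE / M.totalRate * b .E, fun s => ?_⟩
  have hle := hM.expectNext_le (hM.afterArrival_sq_le .H s) (hM.afterArrival_sq_le .E s)
  linear_combination hle + ((s.1 + s.2 : ℝ) ^ 2 - 2 * (s.1 + s.2)) * hM.lamH_div_add_lamE_div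

theorem exists_isSteadyState (hM : M.Admissible) : ∃ μ, M.IsSteadyState μ := by
  obtain ⟨b, hb⟩ := hM.exists_drift_sq
  have hfinite (c : ℕ) :
      {s : MarketState | ENNReal.ofReal (2 * (s.1 + s.2 : ℝ)) ≤ c}.Finite := by
    refine ((finite_Iic c).prod (finite_Iic c)).subset fun s hs => ?_
    have hs' : ENNReal.ofReal (2 * (s.1 + s.2 : ℝ)) ≤ c := hs
    rw [ENNReal.ofReal_le_natCast] at hs'
    have : 2 * (s.1 + s.2) ≤ c := by exact_mod_cast hs'
    constructor <;> simp only [mem_Iic] <;> omega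
  obtain ⟨μ, hμ⟩ := exists_stationary
    (hM.hasDrift_jump (fun _ => sq_nonneg _) (fun _ => by positivity) hb)
    (fun _ => ENNReal.ofReal_ne_top) ENNReal.ofReal_ne_top hfinite
  exact ⟨μ, hM.isSteadyState_iff.2 hμ⟩

theorem isSteadyState_steadyState (hM : M.Admissible) : M.IsSteadyState M.steadyState :=
  Classical.epsilon_spec hM.exists_isSteadyState

theorem isSteadyState_iff_eq_steadyState (hM : M.Admissible) {μ : PMF MarketState} :
    M.IsSteadyState μ ↔ μ = M.steadyState := by
  refine ⟨fun hμ => ?_, fun hμ => hμ ▸ hM.isSteadyState_steadyState⟩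
  exact stationary_unique (fun _ => hM.empty_mem_of_isAbsorbing) (hM.isSteadyState_iff.1 hμ)
    (hM.isSteadyState_iff.1 hM.isSteadyState_steadyState)

theorem meanH_ne_top (hM : M.Admissible) {μ : PMF MarketState} (hμ : M.IsSteadyState μ) :
    meanH μ ≠ ∞ := by
  obtain ⟨b, hb⟩ := hM.exists_drift_sq
  refine ne_top_of_le_ne_top ENNReal.ofReal_ne_top (le_trans (ENNReal.tsum_le_tsum fun s => ?_)
    (hM.tsum_mul_le_of_drift hμ (fun _ => sq_nonneg _) (fun _ => by positivity) hb))
  gcongr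
  rw [← ENNReal.ofReal_natCast]
  exact ENNReal.ofReal_le_ofReal (by linarith [s.1.cast_nonneg (α := ℝ), s.2.cast_nonneg (α := ℝ)])

end Admissible

end SteadyState

section LittlesLaw

open MeasureTheory

theorem unmatched_succ (n : ℕ) (s : MarketState) : M.unmatched (n + 1) s =
    M.lamH / M.totalRate * (M.join .H s * M.unmatched n (s.add .H) +
      M.matchE .H s * M.unmatched n (s.1, s.2 - 1) +
      M.matchH .H s * (1 - 1 / (s.1 : ℝ)) * M.unmatched n (s.1 - 1, s.2)) +
    M.lamE / M.totalRate * (M.join .E s * M.unmatched n (s.add .E) +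
      M.matchE .E s * M.unmatched n (s.1, s.2 - 1) +
      M.matchH .E s * (1 - 1 / (s.1 : ℝ)) * M.unmatched n (s.1 - 1, s.2)) := rfl

/-- The expected number of the `H` agents present in the market distributed according to `μ` who
are not matched by the next `n` arrivals. -/
noncomputable def meanUnmatchedH (M : Market) (μ : PMF MarketState) (n : ℕ) : ℝ≥0∞ :=
  ∑' s, μ s * ENNReal.ofReal (s.1 * M.unmatched n s)

/-- The probability that an `H` agent arriving to the market distributed according to `μ` joins it,
and is not matched by the next `n` arrivals. -/
noncomputable def probWaiting (M : Market) (μ : PMF MarketState) (n : ℕ) : ℝ≥0∞ :=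
  ∑' s, μ s * ENNReal.ofReal (M.join .H s) * ENNReal.ofReal (M.unmatched n (s.add .H))

theorem meanUnmatchedH_zero (μ : PMF MarketState) : M.meanUnmatchedH μ 0 = meanH μ := by
  simp [meanUnmatchedH, meanH, unmatched]

/-- Of the `H` agents present after the next arrival, the new one is present with probability
`lamH / totalRate * join`; each of the others is counted with her probability of having stayed. -/
theorem expectNext_mul_unmatched (n : ℕ) (s : MarketState) :
    M.expectNext (fun s => s.1 * M.unmatched n s) s = s.1 * M.unmatched (n + 1) s +
      M.lamH / M.totalRate * (M.join .H s * M.unmatched n (s.add .H)) := by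
  rw [unmatched_succ]
  obtain ⟨_ | h, e⟩ := s
  · simp [expectNext, afterArrival, matchH_zero, MarketState.add]
  · simp only [expectNext, afterArrival, MarketState.add, Nat.add_sub_cancel]
    push_cast
    field_simp
    ring

namespace Admissible

theorem unmatched_nonneg (hM : M.Admissible) (n : ℕ) (s : MarketState) : 0 ≤ M.unmatched n s := by
  induction n generalizing s with
  | zero => exact zero_le_one
  | succ n ih =>
    have hstay : 0 ≤ 1 - 1 / (s.1 : ℝ) := by
      simpa only [one_div, sub_nonneg] using Nat.cast_inv_le_one s.1
    have hafter : ∀ T, 0 ≤ M.join T s * M.unmatched n (s.add T) +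
        M.matchE T s * M.unmatched n (s.1, s.2 - 1) +
        M.matchH T s * (1 - 1 / (s.1 : ℝ)) * M.unmatched n (s.1 - 1, s.2) := fun T =>
      add_nonneg (add_nonneg (mul_nonneg (hM.join_nonneg T s) (ih _))
        (mul_nonneg (hM.matchE_nonneg T s) (ih _)))
        (mul_nonneg (mul_nonneg (hM.matchH_nonneg T s) hstay) (ih _))
    exact add_nonneg (mul_nonneg hM.lamH_div_totalRate_pos.le (hafter .H))
      (mul_nonneg hM.lamE_div_totalRate_pos.le (hafter .E))

theorem unmatched_succ_le (hM : M.Admissible) (n : ℕ) (s : MarketState) :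
    M.unmatched (n + 1) s ≤ M.expectNext (M.unmatched n) s := by
  have hafter : ∀ T, M.matchH T s * (1 - 1 / (s.1 : ℝ)) * M.unmatched n (s.1 - 1, s.2) ≤
      M.matchH T s * M.unmatched n (s.1 - 1, s.2) := fun T => by
    have := hM.unmatched_nonneg n (s.1 - 1, s.2)
    gcongr
    exact mul_le_of_le_one_right (hM.matchH_nonneg T s) (sub_le_self _ (by positivity))
  have := hM.lamH_div_totalRate_pos
  have := hM.lamE_div_totalRate_pos
  rw [unmatched_succ, expectNext, afterArrival, afterArrival]
  gcongr ?_ * (_ + ?_) + ?_ * (_ + ?_) <;> first | rfl | exact hafter _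

theorem unmatched_le_one (hM : M.Admissible) (n : ℕ) (s : MarketState) : M.unmatched n s ≤ 1 := by
  induction n generalizing s with
  | zero => exact le_rfl
  | succ n ih =>
    calc M.unmatched (n + 1) s ≤ M.expectNext (M.unmatched n) s := hM.unmatched_succ_le n s
      _ ≤ M.expectNext (fun _ => 1) s := hM.expectNext_mono ih s
      _ = 1 := hM.expectNext_const 1 s

variable {μ : PMF MarketState}

theorem meanUnmatchedH_eq_add (hM : M.Admissible) (hμ : M.IsSteadyState μ) (n : ℕ) :
    M.meanUnmatchedH μ n = M.meanUnmatchedH μ (n + 1) +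
      ENNReal.ofReal (M.lamH / M.totalRate) * M.probWaiting μ n := by
  have hnonneg : ∀ n s, 0 ≤ (s.1 : ℝ) * M.unmatched n s := fun n s =>
    mul_nonneg (Nat.cast_nonneg _) (hM.unmatched_nonneg n s)
  have hα := hM.lamH_div_totalRate_pos.le
  have hstep := tsum_push_mul hM.jump μ fun s => ENNReal.ofReal (s.1 * M.unmatched n s)
  rw [hM.isSteadyState_iff.1 hμ] at hstep
  rw [meanUnmatchedH, hstep, probWaiting, ← ENNReal.tsum_mul_left, meanUnmatchedH,
    ← ENNReal.tsum_add]
  refine tsum_congr fun s => ?_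
  have hjoin := hM.join_nonneg .H s
  rw [hM.tsum_jump_mul (hnonneg n), expectNext_mul_unmatched, ENNReal.ofReal_add (hnonneg _ _)
    (mul_nonneg hα (mul_nonneg hjoin (hM.unmatched_nonneg _ _))), ENNReal.ofReal_mul hα,
    ENNReal.ofReal_mul hjoin]
  ring

theorem meanH_eq_add_sum (hM : M.Admissible) (hμ : M.IsSteadyState μ) (N : ℕ) :
    meanH μ = M.meanUnmatchedH μ N +
      ENNReal.ofReal (M.lamH / M.totalRate) * ∑ n ∈ Finset.range N, M.probWaiting μ n := by
  induction N with
  | zero => simp [meanUnmatchedH_zero]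
  | succ N ih =>
    rw [ih, hM.meanUnmatchedH_eq_add hμ N, Finset.sum_range_succ]
    ring

theorem tendsto_probWaiting (hM : M.Admissible) (hμ : M.IsSteadyState μ) :
    Tendsto (M.probWaiting μ) atTop (𝓝 0) := by
  have hα : ENNReal.ofReal (M.lamH / M.totalRate) ≠ 0 := by
    simpa using hM.lamH_div_totalRate_pos
  have hle : ENNReal.ofReal (M.lamH / M.totalRate) * ∑' n, M.probWaiting μ n ≤ meanH μ := by
    rw [← ENNReal.tsum_mul_left, ENNReal.tsum_eq_iSup_nat]
    refine iSup_le fun N => ?_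
    rw [hM.meanH_eq_add_sum hμ N, Finset.mul_sum]
    exact le_add_self
  refine ENNReal.tendsto_atTop_zero_of_tsum_ne_top fun htop => ?_
  rw [htop, ENNReal.mul_top hα, top_le_iff] at hle
  exact hM.meanH_ne_top hμ hle

theorem tendsto_unmatched_add_H (hM : M.Admissible) (hμ : M.IsSteadyState μ) {s : MarketState}
    (hs : μ s ≠ 0) :
    Tendsto (fun n => ENNReal.ofReal (M.unmatched n (s.add .H))) atTop (𝓝 0) := by
  set c : ℝ≥0∞ := μ s * ENNReal.ofReal (M.join .H s)
  have hc : c ≠ 0 := mul_ne_zero hs (by simpa using hM.join_H_pos s)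
  have hlim := ENNReal.Tendsto.div_const (hM.tendsto_probWaiting hμ) (Or.inr hc)
  rw [ENNReal.zero_div] at hlim
  refine tendsto_of_tendsto_of_tendsto_of_le_of_le tendsto_const_nhds hlim (fun _ => zero_le)
    fun n => ?_
  rw [ENNReal.le_div_iff_mul_le (Or.inl hc)
    (Or.inl (ENNReal.mul_ne_top (μ.apply_ne_top _) ENNReal.ofReal_ne_top)), mul_comm]
  exact ENNReal.le_tsum (f := fun s => μ s * ENNReal.ofReal (M.join .H s) *
    ENNReal.ofReal (M.unmatched n (s.add .H))) s

theorem tendsto_mul_unmatched (hM : M.Admissible) (hμ : M.IsSteadyState μ) (s : MarketState) :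
    Tendsto (fun n => μ s * ENNReal.ofReal (s.1 * M.unmatched n s)) atTop (𝓝 0) := by
  obtain ⟨_ | h, e⟩ := s
  · simp
  by_cases hs : μ (h + 1, e) = 0
  · simp [hs]
  have hs' : μ (h, e) ≠ 0 :=
    ne_zero_of_step (hM.isSteadyState_iff.1 hμ) hs (hM.jump_remove_H_ne_zero h e)
  have hlim := ENNReal.Tendsto.const_mul (a := μ (h + 1, e) * ENNReal.ofReal (h + 1 : ℕ))
    (hM.tendsto_unmatched_add_H hμ hs')
    (Or.inr (ENNReal.mul_ne_top (μ.apply_ne_top _) ENNReal.ofReal_ne_top))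
  rw [mul_zero] at hlim
  refine hlim.congr fun n => ?_
  rw [ENNReal.ofReal_mul (Nat.cast_nonneg _), mul_assoc]
  rfl

theorem tendsto_meanUnmatchedH (hM : M.Admissible) (hμ : M.IsSteadyState μ) :
    Tendsto (M.meanUnmatchedH μ) atTop (𝓝 0) := by
  have hlim := tendsto_lintegral_of_dominated_convergence
    (μ := (Measure.count : Measure MarketState))
    (F := fun n s => μ s * ENNReal.ofReal (s.1 * M.unmatched n s)) (f := fun _ => 0)
    (fun s => μ s * (s.1 : ℝ≥0∞)) (fun n => measurable_of_countable _)
    (fun n => Eventually.of_forall fun s => ?_) ?_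
    (Eventually.of_forall (hM.tendsto_mul_unmatched hμ))
  · simp only [lintegral_count, tsum_zero] at hlim
    exact hlim
  · simp only
    gcongr
    rw [← ENNReal.ofReal_natCast]
    exact ENNReal.ofReal_le_ofReal
      (mul_le_of_le_one_right (Nat.cast_nonneg _) (hM.unmatched_le_one _ _))
  · rw [lintegral_count]
    exact hM.meanH_ne_top hμ

theorem meanH_eq_mul_tsum (hM : M.Admissible) (hμ : M.IsSteadyState μ) :
    meanH μ = ENNReal.ofReal (M.lamH / M.totalRate) * ∑' n, M.probWaiting μ n := by
  have hlim := (hM.tendsto_meanUnmatchedH hμ).add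
    (ENNReal.Tendsto.const_mul (a := ENNReal.ofReal (M.lamH / M.totalRate))
      (ENNReal.tendsto_nat_tsum (M.probWaiting μ)) (Or.inr ENNReal.ofReal_ne_top))
  simp only [← hM.meanH_eq_add_sum hμ] at hlim
  rw [zero_add] at hlim
  exact tendsto_nhds_unique tendsto_const_nhds hlim

theorem meanWaitH_eq_mul_tsum (hM : M.Admissible) (μ : PMF MarketState) :
    M.meanWaitH μ = ENNReal.ofReal M.totalRate⁻¹ * ∑' n, M.probWaiting μ n := by
  have hmeas : ∀ n : ℕ, Measurable fun t : ℝ => ENNReal.ofReal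
      (Real.exp (-(M.totalRate * t)) * (M.totalRate * t) ^ n / (n ! : ℝ)) := fun n => by fun_prop
  have hstate : ∀ s : MarketState, ∫⁻ t in Ioi (0 : ℝ), μ s * ENNReal.ofReal (M.join .H s) *
      ∑' n : ℕ, ENNReal.ofReal (Real.exp (-(M.totalRate * t)) * (M.totalRate * t) ^ n / (n ! : ℝ)) *
        ENNReal.ofReal (M.unmatched n (s.add .H)) =
      ∑' n, ENNReal.ofReal M.totalRate⁻¹ * (μ s * ENNReal.ofReal (M.join .H s) *
        ENNReal.ofReal (M.unmatched n (s.add .H))) := by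
    intro s
    rw [lintegral_const_mul _ (Measurable.tsum fun n => (hmeas n).mul_const _),
      lintegral_tsum fun n => ((hmeas n).mul_const _).aemeasurable, ← ENNReal.tsum_mul_left]
    refine tsum_congr fun n => ?_
    rw [lintegral_mul_const _ (hmeas n), lintegral_poisson_pmf hM.totalRate_pos]
    ring
  unfold meanWaitH waitTailH probWaiting
  rw [lintegral_tsum fun s => (Measurable.const_mul (Measurable.tsum fun n =>
    (hmeas n).mul_const _) _).aemeasurable]
  simp only [hstate]
  rw [ENNReal.tsum_comm, ← ENNReal.tsum_mul_left]
  exact tsum_congr fun n => ENNReal.tsum_mul_left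

theorem littles_law (hM : M.Admissible) (hμ : M.IsSteadyState μ) :
    M.meanWaitH μ = ENNReal.ofReal M.lamH⁻¹ * meanH μ := by
  have hH := hM.lamH_pos
  have hΛ := hM.totalRate_pos
  rw [hM.meanWaitH_eq_mul_tsum, hM.meanH_eq_mul_tsum hμ, ← mul_assoc,
    ← ENNReal.ofReal_mul (by positivity)]
  congr 2
  field_simp

end Admissible

end LittlesLaw

end Market

section Concentration

theorem mul_one_sub_exp_neg_nonneg (z : ℝ) : 0 ≤ z * (1 - Real.exp (-z)) := by
  rcases le_total 0 z with hz | hz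
  · exact mul_nonneg hz (by simpa using hz)
  · exact mul_nonneg_of_nonpos_of_nonpos hz (by simpa using hz)

theorem sq_le_one_add_abs_mul (z : ℝ) :
    z ^ 2 ≤ (1 + |z|) * (z * (1 - Real.exp (-z))) := by
  rcases le_total 0 z with hz | hz
  · have hexp : Real.exp (-z) * (z + 1) ≤ 1 := by
      rw [Real.exp_neg, inv_mul_le_one₀ (Real.exp_pos z)]
      exact Real.add_one_le_exp z
    rw [abs_of_nonneg hz]
    nlinarith
  · have hexp : z ^ 2 ≤ z * (1 - Real.exp (-z)) := by nlinarith [Real.add_one_le_exp (-z)]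
    exact hexp.trans (le_mul_of_one_le_left ((sq_nonneg z).trans hexp) (by simp))

theorem abs_le_add_mul_one_sub_exp_neg {δ : ℝ} (hδ : 0 < δ) (z : ℝ) :
    |z| ≤ δ + (1 + δ⁻¹) * (z * (1 - Real.exp (-z))) := by
  have hnonneg := mul_one_sub_exp_neg_nonneg z
  rcases le_or_gt |z| δ with hz | hz
  · exact hz.trans (le_add_of_nonneg_right (by positivity))
  have hz₀ : 0 < |z| := hδ.trans hz
  have hsq : |z| * |z| ≤ |z| * ((1 + |z|⁻¹) * (z * (1 - Real.exp (-z)))) := by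
    rw [abs_mul_abs_self, ← sq, ← mul_assoc, mul_one_add, mul_inv_cancel₀ hz₀.ne', add_comm]
    exact sq_le_one_add_abs_mul z
  calc |z| ≤ (1 + |z|⁻¹) * (z * (1 - Real.exp (-z))) := le_of_mul_le_mul_left hsq hz₀
    _ ≤ (1 + δ⁻¹) * (z * (1 - Real.exp (-z))) := by gcongr
    _ ≤ δ + (1 + δ⁻¹) * (z * (1 - Real.exp (-z))) := le_add_of_nonneg_left hδ.le

open Real in
theorem sub_posLog_mul_le {r y : ℝ} (hr : 0 ≤ r) (hy : 0 ≤ y) :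
    (y - log⁺ r) * (r * exp (-y) - 1) ≤ -((y - log⁺ r) * (1 - exp (-(y - log⁺ r)))) := by
  have hexp : exp (-(y - log⁺ r)) = max 1 r * exp (-y) := by
    rw [neg_sub, sub_eq_add_neg, exp_add, posLog_eq_log_max_one hr,
      exp_log (lt_max_of_lt_left one_pos)]
  rw [hexp]
  rcases le_total 1 r with h | h
  · rw [max_eq_right h]
    linarith
  · rw [max_eq_left h, (posLog_eq_zero_iff r).2 (by rwa [abs_of_nonneg hr])]
    nlinarith [mul_nonneg hy (exp_pos (-y)).le]

theorem abs_toReal_tsum_sub_le {S : Type*} {μ : PMF S} {f : S → ℝ} {c R : ℝ} (hc : 0 ≤ c)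
    (hR : 0 ≤ R) (h : ∑' s, μ s * ENNReal.ofReal |f s - c| ≤ ENNReal.ofReal R) :
    |(∑' s, μ s * ENNReal.ofReal (f s)).toReal - c| ≤ R := by
  have hcompare : ∀ x y : S → ℝ, (∀ s, x s ≤ y s + |f s - c|) →
      ∑' s, μ s * ENNReal.ofReal (x s) ≤ ∑' s, μ s * ENNReal.ofReal (y s) + ENNReal.ofReal R := by
    intro x y hxy
    refine le_trans ?_ (add_le_add_right h _)
    rw [← ENNReal.tsum_add]
    refine ENNReal.tsum_le_tsum fun s => ?_
    rw [← mul_add]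
    gcongr
    exact (ENNReal.ofReal_le_ofReal (hxy s)).trans ENNReal.ofReal_add_le
  have hconst : ∑' s, μ s * ENNReal.ofReal c = ENNReal.ofReal c := by
    rw [ENNReal.tsum_mul_right, μ.tsum_coe, one_mul]
  have hupper := hcompare f (fun _ => c) fun s => by linarith [le_abs_self (f s - c)]
  have hlower := hcompare (fun _ => c) f fun s => by linarith [neg_abs_le (f s - c)]
  rw [hconst] at hupper hlower
  have hfin : ∑' s, μ s * ENNReal.ofReal (f s) ≠ ∞ := ne_top_of_le_ne_top (by finiteness) hupper
  rw [← ENNReal.ofReal_toReal hfin, ← ENNReal.ofReal_add ENNReal.toReal_nonneg hR,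
    ENNReal.ofReal_le_ofReal_iff (by positivity)] at hlower
  rw [← ENNReal.ofReal_toReal hfin, ← ENNReal.ofReal_add hc hR,
    ENNReal.ofReal_le_ofReal_iff (by positivity)] at hupper
  exact abs_sub_le_iff.2 ⟨by linarith, by linarith⟩

end Concentration

namespace Market

section Concentration

/-- The decay rate, in the number of waiting `H` agents, of the probability that an arriving `H`
agent forms a 2-cycle with none of them. It is the scale of the number of waiting `H` agents. -/
noncomputable def decay (M : Market) : ℝ := -Real.log (1 - M.pH ^ 2)

/-- The value around which `decay` times the number of waiting `H` agents concentrates. If it is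
positive, an arriving `H` agent then meets no match among them with probability
`totalRate / (2 * lamH)`, which balances the flows of `H` agents in and out. -/
noncomputable def level (M : Market) : ℝ := Real.posLog (2 * (M.lamH / M.totalRate))

/-- The Lyapunov function for the concentration of the number of waiting `H` agents around `a`. The
linear term makes up for the matches of arriving agents with waiting `E` agents. -/
noncomputable def lyapunov (a : ℝ) (s : MarketState) : ℝ := ((s.1 : ℝ) - a) ^ 2 / 2 + a * s.2

theorem level_nonneg (M : Market) : 0 ≤ M.level := Real.posLog_nonneg

variable {M : Market}

theorem expectNext_const_mul (c : ℝ) (f : MarketState → ℝ) (s : MarketState) :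
    M.expectNext (fun s => c * f s) s = c * M.expectNext f s := by
  unfold expectNext afterArrival
  ring

theorem lyapunov_nonneg {a : ℝ} (ha : 0 ≤ a) (s : MarketState) : 0 ≤ lyapunov a s := by
  unfold lyapunov
  positivity

namespace Admissible

theorem decay_pos (hM : M.Admissible) : 0 < M.decay :=
  neg_pos.2 (Real.log_neg (sub_pos.2 (pow_lt_one₀ hM.pH_pos.le hM.pH_lt_one two_ne_zero))
    (sub_lt_self _ (pow_pos hM.pH_pos 2)))

theorem one_sub_p_mul_pH_pow_eq_exp (hM : M.Admissible) (n : ℕ) :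
    (1 - M.p .H * M.pH) ^ n = Real.exp (-(M.decay * n)) := by
  have hpos : 0 < 1 - M.pH ^ 2 := sub_pos.2 (pow_lt_one₀ hM.pH_pos.le hM.pH_lt_one two_ne_zero)
  rw [decay, neg_mul, neg_neg, mul_comm (Real.log _), Real.exp_nat_mul, Real.exp_log hpos, sq]
  rfl

theorem afterArrival_H_lyapunov_le (hM : M.Admissible) {a : ℝ} (s : MarketState) :
    M.afterArrival (lyapunov a) .H s ≤
      lyapunov a s + (s.1 - a) * (2 * (1 - M.p .H * M.pH) ^ s.1 - 1) + 1 / 2 := by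
  refine (afterArrival_cast (fun x y => (x - a) ^ 2 / 2 + a * y) .H s).trans_le ?_
  have hA := hM.one_sub_p_mul_pH_pow_pos .H s.1
  have hu := hM.one_sub_p_mul_pE_pow_le_one .H s.2
  simp only [join, matchE, matchH, MarketState.add, lyapunov]
  push_cast
  set A := (1 - M.p .H * M.pH) ^ s.1
  set u := (1 - M.p .H * M.pE) ^ s.2
  have hslack : 0 ≤ A * (1 - u) * (s.1 + 1 / 2) :=
    mul_nonneg (mul_nonneg hA.le (sub_nonneg.2 hu)) (by positivity)
  linarith

theorem afterArrival_E_lyapunov_le (hM : M.Admissible) {a : ℝ} (ha : 0 ≤ a) (s : MarketState) :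
    M.afterArrival (lyapunov a) .E s ≤
      lyapunov a s - (s.1 - a) + (1 / 2 + (M.pE * M.pH)⁻¹) := by
  refine (afterArrival_cast (fun x y => (x - a) ^ 2 / 2 + a * y) .E s).trans_le ?_
  have hc := hM.one_sub_p_mul_pH_pow_pos .E s.1
  have hv := hM.one_sub_p_mul_pE_pow_le_one .E s.2
  have hch : (1 - M.p .E * M.pH) ^ s.1 * s.1 ≤ (M.pE * M.pH)⁻¹ :=
    one_sub_pow_mul_le_inv (hM.p_mul_pH_pos .E) (hM.p_mul_pH_lt_one .E).le s.1
  simp only [join, matchE, matchH, MarketState.add, lyapunov]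
  push_cast
  set c := (1 - M.p .E * M.pH) ^ s.1
  set v := (1 - M.p .E * M.pE) ^ s.2
  have hslack : 0 ≤ c * a * (1 - v) := mul_nonneg (mul_nonneg hc.le ha) (sub_nonneg.2 hv)
  linarith

theorem expectNext_lyapunov_le (hM : M.Admissible) {a : ℝ} (ha : 0 ≤ a) (s : MarketState) :
    M.expectNext (lyapunov a) s ≤ lyapunov a s +
      (s.1 - a) * (2 * (M.lamH / M.totalRate) * (1 - M.p .H * M.pH) ^ s.1 - 1) +
        (1 / 2 + (M.pE * M.pH)⁻¹) := by
  have hle := hM.expectNext_le (hM.afterArrival_H_lyapunov_le s)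
    (hM.afterArrival_E_lyapunov_le ha s)
  have hαk : 0 ≤ M.lamH / M.totalRate * (M.pE * M.pH)⁻¹ :=
    mul_nonneg hM.lamH_div_totalRate_pos.le (inv_nonneg.2 (hM.p_mul_pH_pos .E).le)
  have hβ := eq_sub_of_add_eq' hM.lamH_div_add_lamE_div
  rw [hβ] at hle
  linarith

theorem decay_mul_expectNext_lyapunov_le (hM : M.Admissible) (s : MarketState) :
    M.decay * M.expectNext (lyapunov (M.level / M.decay)) s +
        (M.decay * s.1 - M.level) * (1 - Real.exp (-(M.decay * s.1 - M.level))) ≤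
      M.decay * lyapunov (M.level / M.decay) s + M.decay * (1 / 2 + (M.pE * M.pH)⁻¹) := by
  have hθ := hM.decay_pos
  have hle := mul_le_mul_of_nonneg_left
    (hM.expectNext_lyapunov_le (div_nonneg M.level_nonneg hθ.le) s) hθ.le
  have hdrift := sub_posLog_mul_le (r := 2 * (M.lamH / M.totalRate)) (y := M.decay * s.1)
    (mul_nonneg zero_le_two hM.lamH_div_totalRate_pos.le) (by positivity)
  rw [← level, ← hM.one_sub_p_mul_pH_pow_eq_exp] at hdrift
  have hscale : M.decay * (s.1 - M.level / M.decay) = M.decay * s.1 - M.level := by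
    rw [mul_sub, mul_div_cancel₀ _ hθ.ne']
  rw [mul_add, mul_add, ← mul_assoc M.decay (_ - _), hscale] at hle
  linarith

theorem tsum_mul_abs_decay_mul_sub_level_le (hM : M.Admissible) {μ : PMF MarketState}
    (hμ : M.IsSteadyState μ) {δ : ℝ} (hδ : 0 < δ) :
    ∑' s, μ s * ENNReal.ofReal |M.decay * s.1 - M.level| ≤
      ENNReal.ofReal (δ + (1 + δ⁻¹) * (M.decay * (1 / 2 + (M.pE * M.pH)⁻¹))) := by
  have hθ := hM.decay_pos
  have ha : 0 ≤ M.level / M.decay := div_nonneg M.level_nonneg hθ.le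
  refine hM.tsum_mul_le_of_drift hμ
    (V := fun s => (1 + δ⁻¹) * M.decay * lyapunov (M.level / M.decay) s)
    (fun s => mul_nonneg (by positivity) (lyapunov_nonneg ha s)) (fun _ => abs_nonneg _) fun s => ?_
  rw [expectNext_const_mul]
  have hdrift := mul_le_mul_of_nonneg_left (hM.decay_mul_expectNext_lyapunov_le s)
    (show 0 ≤ 1 + δ⁻¹ by positivity)
  linarith [abs_le_add_mul_one_sub_exp_neg hδ (M.decay * s.1 - M.level)]

theorem abs_decay_mul_meanH_sub_level_le (hM : M.Admissible) {μ : PMF MarketState}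
    (hμ : M.IsSteadyState μ) {δ : ℝ} (hδ : 0 < δ) :
    |M.decay * (meanH μ).toReal - M.level| ≤
      δ + (1 + δ⁻¹) * (M.decay * (1 / 2 + (M.pE * M.pH)⁻¹)) := by
  have hθ := hM.decay_pos
  have hmean : M.decay * (meanH μ).toReal =
      (∑' s, μ s * ENNReal.ofReal (M.decay * s.1)).toReal := by
    rw [← ENNReal.toReal_ofReal_mul _ _ hθ.le, meanH, ← ENNReal.tsum_mul_left]
    congr 2 with s
    rw [ENNReal.ofReal_mul hθ.le, ENNReal.ofReal_natCast, mul_left_comm]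
  have hk : 0 < (M.pE * M.pH)⁻¹ := inv_pos.2 (hM.p_mul_pH_pos .E)
  rw [hmean]
  exact abs_toReal_tsum_sub_le M.level_nonneg (by positivity)
    (hM.tsum_mul_abs_decay_mul_sub_level_le hμ hδ)

end Admissible

end Concentration

end Market

section Calculus

/-- The function whose value is `1` where the derivative of the limiting waiting time vanishes, in
terms of the ratio `y` of the arrival rates of `H` and `E` agents. -/
noncomputable def criticalFn (y : ℝ) : ℝ := (y + 1) * Real.log (2 - 2 / (y + 1))

/-- The limit of the scaled average waiting time of `H` agents, who arrive at rate `l`, when `E`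
agents arrive at rate `c`. -/
noncomputable def limitWait (c l : ℝ) : ℝ≥0 := (Real.posLog (2 * (l / (l + c))) / l).toNNReal

theorem two_sub_two_div_add_one {y : ℝ} (hy : y + 1 ≠ 0) :
    2 - 2 / (y + 1) = 2 * y / (y + 1) := by
  field_simp
  ring

theorem hasDerivAt_criticalFn {y : ℝ} (hy : 0 < y) :
    HasDerivAt criticalFn (Real.log (2 - 2 / (y + 1)) + 1 / y) y := by
  have hy₁ : y + 1 ≠ 0 := by positivity
  have hadd : HasDerivAt (fun y : ℝ => y + 1) 1 y := (hasDerivAt_id y).add_const 1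
  have harg : HasDerivAt (fun y : ℝ => 2 - 2 / (y + 1)) (2 / (y + 1) ^ 2) y := by
    refine (((hasDerivAt_const y (2 : ℝ)).div hadd hy₁).const_sub 2).congr_deriv ?_
    field_simp
    ring
  have hne : 2 - 2 / (y + 1) ≠ 0 := by
    rw [two_sub_two_div_add_one hy₁]
    positivity
  refine (hadd.mul (harg.log hne)).congr_deriv ?_
  rw [one_mul, two_sub_two_div_add_one hy₁]
  field_simp

theorem strictMonoOn_criticalFn : StrictMonoOn criticalFn (Ici 1) := by
  refine strictMonoOn_of_deriv_pos (convex_Ici 1) (fun y hy =>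
    (hasDerivAt_criticalFn (one_pos.trans_le hy)).continuousAt.continuousWithinAt) fun y hy => ?_
  rw [interior_Ici, mem_Ioi] at hy
  have hy₀ : 0 < y := one_pos.trans hy
  have hlog : 0 ≤ Real.log (2 - 2 / (y + 1)) := by
    refine Real.log_nonneg ?_
    have : 2 / (y + 1) ≤ 1 := by rw [div_le_one (by linarith)]; linarith
    linarith
  rw [(hasDerivAt_criticalFn hy₀).deriv]
  positivity

theorem criticalFn_nonpos_of_le_neg_one {y : ℝ} (hy : y ≤ -1) : criticalFn y ≤ 0 := by
  have hy₁ : y + 1 ≤ 0 := by linarith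
  have hdiv : 2 / (y + 1) ≤ 0 := div_nonpos_of_nonneg_of_nonpos zero_le_two hy₁
  exact mul_nonpos_of_nonpos_of_nonneg hy₁ (Real.log_nonneg (by linarith))

theorem criticalFn_lt_one_of_abs_lt_one {y : ℝ} (hy : |y| < 1) : criticalFn y < 1 := by
  rcases eq_or_ne y 0 with rfl | hy₀
  · simp [criticalFn]
  have hy₁ : 0 < y + 1 := by linarith [(abs_lt.1 hy).1]
  have hne : 2 * y / (y + 1) ≠ 0 := by positivity
  calc criticalFn y = (y + 1) * (Real.log (2 * y / (y + 1)) - 1 + 1) := by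
        rw [criticalFn, two_sub_two_div_add_one hy₁.ne', sub_add_cancel]
    _ ≤ (y + 1) * Real.exp (Real.log (2 * y / (y + 1)) - 1) := by
        gcongr
        exact Real.add_one_le_exp _
    _ = 2 * |y| / Real.exp 1 := by
        rw [Real.exp_sub, Real.exp_log_eq_abs hne, abs_div, abs_mul, abs_two, abs_of_pos hy₁]
        field_simp
    _ < 1 := by
        rw [div_lt_one (Real.exp_pos 1)]
        linarith [Real.exp_one_gt_d9]

theorem criticalFn_lt_one_of_lt_one {y : ℝ} (hy : y < 1) : criticalFn y < 1 := by
  rcases le_or_gt y (-1) with hy₁ | hy₁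
  · exact (criticalFn_nonpos_of_le_neg_one hy₁).trans_lt one_pos
  · exact criticalFn_lt_one_of_abs_lt_one (abs_lt.2 ⟨hy₁, hy⟩)

theorem criticalFn_left_lt_one : criticalFn 2.175 < 1 := by
  have hlog : Real.log (174 / 127) < 40 / 127 := by
    rw [Real.log_lt_iff_lt_exp (by norm_num)]
    refine lt_of_lt_of_le ?_ (Real.sum_le_exp_of_nonneg (by norm_num) 6)
    norm_num [Finset.sum_range_succ, Nat.factorial]
  unfold criticalFn
  norm_num at hlog ⊢
  linarith

theorem one_lt_criticalFn_right : 1 < criticalFn 2.185 := by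
  have hlog : 200 / 637 < Real.log (874 / 637) := by
    rw [Real.lt_log_iff_exp_lt (by norm_num)]
    refine lt_of_le_of_lt (Real.exp_bound' (n := 5) (by norm_num) (by norm_num) (by norm_num)) ?_
    norm_num [Finset.sum_range_succ, Nat.factorial]
  unfold criticalFn
  norm_num at hlog ⊢
  linarith

theorem exists_forall_criticalFn_eq_one_iff :
    ∃ x : ℝ, (∀ y, criticalFn y = 1 ↔ y = x) ∧ |x - 2.18| < 0.005 := by
  obtain ⟨x, ⟨hx₁, hx₂⟩, hx⟩ := intermediate_value_Ioo (show (2.175 : ℝ) ≤ 2.185 by norm_num)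
    (fun y hy => (hasDerivAt_criticalFn
      (lt_of_lt_of_le (by norm_num) hy.1)).continuousAt.continuousWithinAt)
    ⟨criticalFn_left_lt_one, one_lt_criticalFn_right⟩
  refine ⟨x, fun y => ⟨fun hy => ?_, fun hy => hy ▸ hx⟩,
    abs_sub_lt_iff.2 ⟨by linarith, by linarith⟩⟩
  have hy₁ : 1 ≤ y := not_lt.1 fun h => (criticalFn_lt_one_of_lt_one h).ne hy
  exact strictMonoOn_criticalFn.injOn hy₁ (by rw [mem_Ici]; linarith) (hy.trans hx.symm)

theorem hasDerivAt_log_two_mul_div_div {c l : ℝ} (hc : 0 < c) (hl : 0 < l) :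
    HasDerivAt (fun l => Real.log (2 * (l / (l + c))) / l)
      (c / ((l + c) * l ^ 2) * (1 - criticalFn (l / c))) l := by
  have harg : HasDerivAt (fun l : ℝ => 2 * (l / (l + c))) (2 * (c / (l + c) ^ 2)) l := by
    refine (((hasDerivAt_id l).div ((hasDerivAt_id l).add_const c)
      (show l + c ≠ 0 by positivity)).const_mul 2).congr_deriv ?_
    simp only [id]
    ring
  have hratio : 2 - 2 / (l / c + 1) = 2 * (l / (l + c)) := by
    field_simp
    ring
  refine ((harg.log (by positivity)).div (hasDerivAt_id l) hl.ne').congr_deriv ?_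
  simp only [criticalFn, hratio, id]
  field_simp

variable {c l x : ℝ}

theorem one_le_two_mul_div_add (hc : 0 < c) (hl : c ≤ l) : 1 ≤ 2 * (l / (l + c)) := by
  rw [← mul_div_assoc, one_le_div (by linarith)]
  linarith

theorem limitWait_eq (hc : 0 < c) (hl : c ≤ l) :
    limitWait c l = (Real.log (2 * (l / (l + c))) / l).toNNReal := by
  rw [limitWait, Real.posLog_eq_log ((one_le_two_mul_div_add hc hl).trans (le_abs_self _))]

theorem limitWait_lt_limitWait_iff (hc : 0 < c) (hl : c ≤ l) {l' : ℝ} (hl' : c ≤ l') :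
    limitWait c l < limitWait c l' ↔
      Real.log (2 * (l / (l + c))) / l < Real.log (2 * (l' / (l' + c))) / l' := by
  rw [limitWait_eq hc hl, limitWait_eq hc hl', Real.toNNReal_lt_toNNReal_iff_of_nonneg]
  exact div_nonneg (Real.log_nonneg (one_le_two_mul_div_add hc hl)) (hc.le.trans hl)

theorem strictMonoOn_limitWait (hc : 0 < c) (hx₁ : 1 ≤ x) (hx : criticalFn x = 1) :
    StrictMonoOn (limitWait c) (Icc c (x * c)) := by
  suffices h : StrictMonoOn (fun l => Real.log (2 * (l / (l + c))) / l) (Icc c (x * c)) from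
    fun l hl l' hl' hlt => (limitWait_lt_limitWait_iff hc hl.1 hl'.1).2 (h hl hl' hlt)
  refine strictMonoOn_of_deriv_pos (convex_Icc _ _) (fun l hl => (hasDerivAt_log_two_mul_div_div hc
    (hc.trans_le hl.1)).continuousAt.continuousWithinAt) fun l hl => ?_
  rw [interior_Icc] at hl
  have hl₀ : 0 < l := hc.trans hl.1
  have hlt : criticalFn (l / c) < criticalFn x :=
    strictMonoOn_criticalFn ((one_lt_div hc).2 hl.1).le hx₁ ((div_lt_iff₀ hc).2 hl.2)
  rw [(hasDerivAt_log_two_mul_div_div hc hl₀).deriv]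
  exact mul_pos (by positivity) (by linarith)

theorem strictAntiOn_limitWait (hc : 0 < c) (hx₁ : 1 ≤ x) (hx : criticalFn x = 1) :
    StrictAntiOn (limitWait c) (Ici (x * c)) := by
  have hle : ∀ l ∈ Ici (x * c), c ≤ l := fun l hl => (le_mul_of_one_le_left hc.le hx₁).trans hl
  suffices h : StrictAntiOn (fun l => Real.log (2 * (l / (l + c))) / l) (Ici (x * c)) from
    fun l hl l' hl' hlt =>
      (limitWait_lt_limitWait_iff hc (hle l' hl') (hle l hl)).2 (h hl hl' hlt)
  refine strictAntiOn_of_deriv_neg (convex_Ici _) (fun l hl => (hasDerivAt_log_two_mul_div_div hc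
    (hc.trans_le (hle l hl))).continuousAt.continuousWithinAt) fun l hl => ?_
  have hl₀ : 0 < l := hc.trans_le (hle l (interior_subset hl))
  rw [interior_Ici, mem_Ioi, ← lt_div_iff₀ hc] at hl
  have hlt : criticalFn x < criticalFn (l / c) :=
    strictMonoOn_criticalFn hx₁ (hx₁.trans hl.le) hl
  rw [(hasDerivAt_log_two_mul_div_div hc hl₀).deriv]
  exact mul_neg_of_pos_of_neg (by positivity) (by linarith)

end Calculus

section Limit

theorem tendsto_neg_log_one_sub_div :
    Tendsto (fun q : ℝ => -Real.log (1 - q) / q) (𝓝[≠] 0) (𝓝 1) := by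
  have hderiv : HasDerivAt (fun q : ℝ => -Real.log (1 - q)) 1 0 :=
    (((hasDerivAt_id (0 : ℝ)).const_sub 1).log (by simp)).fun_neg.congr_deriv (by simp)
  refine hderiv.tendsto_slope_zero.congr fun q => ?_
  simp [div_eq_inv_mul]

theorem tendsto_decay_div_sq (lamH lamE pE : ℝ) :
    Tendsto (fun pH => Market.decay ⟨lamH, lamE, pH, pE⟩ / pH ^ 2) (𝓝[>] 0) (𝓝 1) := by
  have hsq : Tendsto (fun pH : ℝ => pH ^ 2) (𝓝[>] 0) (𝓝[≠] 0) := by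
    refine tendsto_nhdsWithin_of_tendsto_nhds_of_eventually_within _ ?_ ?_
    · exact ((continuous_pow 2).tendsto' 0 0 (by norm_num)).mono_left nhdsWithin_le_nhds
    · filter_upwards [self_mem_nhdsWithin] with pH hpH
      exact pow_ne_zero 2 (ne_of_gt hpH)
  exact tendsto_neg_log_one_sub_div.comp hsq

theorem tendsto_decay_mul_half_add_inv (lamH lamE pE : ℝ) :
    Tendsto (fun pH => Market.decay ⟨lamH, lamE, pH, pE⟩ * (1 / 2 + (pE * pH)⁻¹)) (𝓝[>] 0)
      (𝓝 0) := by
  have hcont : Tendsto (fun pH : ℝ => pH ^ 2 / 2 + pH * pE⁻¹) (𝓝[>] 0) (𝓝 0) :=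
    ((by fun_prop : Continuous fun pH : ℝ => pH ^ 2 / 2 + pH * pE⁻¹).tendsto' 0 0
      (by norm_num)).mono_left nhdsWithin_le_nhds
  have hlim := (tendsto_decay_div_sq lamH lamE pE).mul hcont
  rw [mul_zero] at hlim
  refine hlim.congr' ?_
  filter_upwards [self_mem_nhdsWithin] with pH hpH
  have hpH₀ : pH ≠ 0 := ne_of_gt hpH
  rw [mul_inv]
  field_simp

variable {lamH lamE pE : ℝ}

theorem eventually_admissible (hH : 0 < lamH) (hE : 0 < lamE) (hpE : 0 < pE) (hpE₁ : pE ≤ 1) :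
    ∀ᶠ pH in 𝓝[>] (0 : ℝ), (⟨lamH, lamE, pH, pE⟩ : Market).Admissible := by
  filter_upwards [Ioo_mem_nhdsGT one_pos] with pH hpH
  exact ⟨hH, hE, hpH.1, hpH.2, hpE, hpE₁⟩

theorem tendsto_decay_mul_meanH (hH : 0 < lamH) (hE : 0 < lamE) (hpE : 0 < pE) (hpE₁ : pE ≤ 1) :
    Tendsto (fun pH => Market.decay ⟨lamH, lamE, pH, pE⟩ *
        (Market.meanH (Market.steadyState ⟨lamH, lamE, pH, pE⟩)).toReal)
      (𝓝[>] 0) (𝓝 (Real.posLog (2 * (lamH / (lamH + lamE))))) := by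
  rw [Metric.tendsto_nhds]
  intro ε hε
  have herror := ((tendsto_decay_mul_half_add_inv lamH lamE pE).const_mul
    (1 + (ε / 2)⁻¹)).const_add (ε / 2)
  rw [mul_zero, add_zero] at herror
  filter_upwards [eventually_admissible hH hE hpE hpE₁,
    herror.eventually_lt_const (half_lt_self hε)] with pH hM hlt
  exact (hM.abs_decay_mul_meanH_sub_level_le hM.isSteadyState_steadyState
    (half_pos hε)).trans_lt hlt

theorem tendsto_sq_mul_meanWaitH (hH : 0 < lamH) (hE : 0 < lamE) (hpE : 0 < pE) (hpE₁ : pE ≤ 1) :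
    Tendsto (fun pH => ENNReal.ofReal (pH ^ 2) * Market.meanWaitH ⟨lamH, lamE, pH, pE⟩
        (Market.steadyState ⟨lamH, lamE, pH, pE⟩))
      (𝓝[>] 0) (𝓝 (limitWait lamE lamH : ℝ≥0∞)) := by
  have hlim := ((tendsto_decay_mul_meanH hH hE hpE hpE₁).div
    (tendsto_decay_div_sq lamH lamE pE) one_ne_zero).div_const lamH
  rw [div_one] at hlim
  refine (ENNReal.tendsto_ofReal hlim).congr' ?_
  filter_upwards [eventually_admissible hH hE hpE hpE₁] with pH hM
  have hsteady := hM.isSteadyState_steadyState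
  rw [hM.littles_law hsteady, ← ENNReal.ofReal_toReal (hM.meanH_ne_top hsteady),
    ← ENNReal.ofReal_mul (inv_nonneg.2 hH.le), ← ENNReal.ofReal_mul (sq_nonneg pH)]
  congr 1
  have hdecay := hM.decay_pos
  have hpH : 0 < pH := hM.pH_pos
  simp only [Pi.div_apply]
  field_simp

end Limit

theorem mainTheorem5_general :
    ∃ x : ℝ,
      (∀ y : ℝ, (y + 1) * Real.log (2 - 2 / (y + 1)) = 1 ↔ y = x) ∧
      |x - 2.18| < 0.005 ∧
      ∀ lamE : ℝ, 0 < lamE → ∀ pE : ℝ, 0 < pE → pE ≤ 1 →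
        (∀ lamH : ℝ, 0 < lamH → ∀ pH : ℝ, 0 < pH → pH < 1 → ∀ μ : PMF MarketState,
          Market.IsSteadyState ⟨lamH, lamE, pH, pE⟩ μ ↔
            μ = Market.steadyState ⟨lamH, lamE, pH, pE⟩) ∧
        (∀ lamH : ℝ, 0 < lamH →
          Tendsto
            (fun pH : ℝ => ENNReal.ofReal (pH ^ 2) *
              Market.meanWaitH ⟨lamH, lamE, pH, pE⟩ (Market.steadyState ⟨lamH, lamE, pH, pE⟩))
            (𝓝[>] 0) (𝓝 (limitWait lamE lamH : ℝ≥0∞))) ∧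
        StrictMonoOn (limitWait lamE) (Icc lamE (x * lamE)) ∧
        StrictAntiOn (limitWait lamE) (Ici (x * lamE)) := by
  obtain ⟨x, huniq, hx⟩ := exists_forall_criticalFn_eq_one_iff
  have hx₁ : 1 ≤ x := by linarith [(abs_lt.1 hx).1]
  have hroot : criticalFn x = 1 := (huniq x).2 rfl
  refine ⟨x, huniq, hx, fun lamE hE pE hpE hpE₁ => ⟨fun lamH hH pH hpH hpH₁ μ => ?_,
    fun lamH hH => tendsto_sq_mul_meanWaitH hH hE hpE hpE₁,
    strictMonoOn_limitWait hE hx₁ hroot, strictAntiOn_limitWait hE hx₁ hroot⟩⟩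
  exact Market.Admissible.isSteadyState_iff_eq_steadyState ⟨hH, hE, hpH, hpH₁, hpE, hpE₁⟩

theorem mainTheorem5 :
    ∃ x : ℝ,
      (∀ y : ℝ, (y + 1) * Real.log (2 - 2 / (y + 1)) = 1 ↔ y = x) ∧
      |x - 2.18| < 0.005 ∧
      ∀ lamE : ℝ, 0 < lamE → ∀ pE : ℝ, 0 < pE → pE ≤ 1 →
        ∃ (π : ℝ → ℝ → PMF MarketState) (W : ℝ → ℝ≥0),
          -- `π lamH pH` is the unique steady-state distribution
          (∀ lamH : ℝ, lamE < lamH → ∀ pH : ℝ, 0 < pH → pH < 1 →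
            ∀ μ : PMF MarketState,
              Market.IsSteadyState ⟨lamH, lamE, pH, pE⟩ μ ↔ μ = π lamH pH) ∧
          -- `W lamH` is the limiting average waiting time of `H` agents (scaled by `pH ^ 2`)
          (∀ lamH : ℝ, lamE < lamH →
            Tendsto
              (fun pH : ℝ => ENNReal.ofReal (pH ^ 2) *
                Market.meanWaitH ⟨lamH, lamE, pH, pE⟩ (π lamH pH))
              (𝓝[>] 0) (𝓝 (W lamH : ℝ≥0∞))) ∧
          StrictMonoOn W (Ioo lamE (x * lamE)) ∧
          StrictAntiOn W (Ioi (x * lamE)) := by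
  obtain ⟨x, huniq, hx, h⟩ := mainTheorem5_general
  refine ⟨x, huniq, hx, fun lamE hE pE hpE hpE₁ => ?_⟩
  obtain ⟨hsteady, hlim, hmono, hanti⟩ := h lamE hE pE hpE hpE₁
  exact ⟨fun lamH pH => Market.steadyState ⟨lamH, lamE, pH, pE⟩, limitWait lamE,
    fun lamH hH => hsteady lamH (hE.trans hH), fun lamH hH => hlim lamH (hE.trans hH),
    hmono.mono Ioo_subset_Icc_self, hanti.mono Ioi_subset_Ici_self⟩
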